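/- **Mean waiting time lower bound.** Fix the number $I\ge 1$ of job types and service rates $\mu_1,\dots,\mu_I>0$. For every $n$ consider a multiserver-job system with $n$ servers: type $i$ jobs arrive according to independent Poisson processes of rate $\lambda_i=\lambda_i(n)>0$, each type $i$ job needs $\ell_i=\ell_i(n)\ge 1$ servers simultaneously while in service, and its service time is exponential with rate $\mu_i$, all independent; the types are sorted so that $\ell_1\le\dots\le\ell_I$. Let $$\lambda=\sum_{i=1}^I\lambda_i,\quad \mu_{\min}=\min_i\mu_i,\quad \delta_i=n-\sum_{j=1}^i\frac{\lambda_j\ell_j}{\mu_j},\quad \sigma_i^2=\sum_{j=1}^i\frac{\lambda_j\ell_j^2}{\mu_j^2},\quad \delta=\delta_I,\quad \sigma^2=\sigma_I^2,\quad \ell_{\max}=\ell_I .$$ Assume that, as $n\to\infty$, 1. $\delta=o\!\left(\sqrt{\sigma^2}/\log n\right)$, and 2. there is a constant $\epsilon_0\in(0,1)$ with $\ell_{\max}\le\epsilon_0\,\delta$ for all sufficiently large $n$. Then the critical index $i^*=\min\{i\in\{1,\dots,I\}:\ \delta_i=o(\sqrt{\sigma_i^2}/\log n)\}$ is well defined,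 and under any scheduling policy $$\mathbb E[T^w(\infty)]\ \ge\ \max_{i^*\le i\le I}\frac1\lambda\,\frac{\mu_{\min}\,\sigma_i^2}{\ell_i\,\delta_i}\cdot(1-o(1))\ =\ \Omega\!\left(\max_{i^*\le i\le I}\frac1\lambda\,\frac{\sigma_i^2}{\ell_i\,\delta_i}\right),$$ where the $o(1)$ term, and the constant and the threshold on $n$ in $\Omega(\cdot)$, do not depend on the policy. Here a scheduling policy decides at any moment which of the jobs present are in service, subject to the jobs in service needing at most $n$ servers in total. It may preempt and later resume jobs, may randomize, and does not know the remaining service times; the system under the policy is a continuous-time Markov chain with countable state space and bounded transition rates, whose state records the types of the jobs present in order of arrival, which of them are in service, and any further memory of the policy. The chain is taken in a stationary distribution. The waiting time $T^w_i(\infty)$ is the total time that a type $i$ job, arriving at the system in steady state, spends in the system without being in service, and $\mathbb E[T^w(\infty)]=\frac1\lambda\sum_{i=1}^I\lambda_i\,\mathbb E[T^w_i(\infty)]\in[0,\infty]$. -/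

import Mathlib

open MeasureTheory ProbabilityTheory Filter Topology Asymptotics
open scoped ENNReal NNReal

noncomputable section

/-- Data of one multiserver-job system with job types indexed by `Fin I`: type `i` jobs arrive
according to a Poisson process of rate `arr i`, occupy `need i` servers simultaneously while in
service, and have exponential service times of rate `srv i`. Types are sorted by server need. -/
structure MSJSystem (I : ℕ) where
  /-- the number of servers -/
  servers : ℕ
  /-- the arrival rates -/
  arr : Fin I → ℝ
  /-- the service rates -/
  srv : Fin I → ℝ
  /-- the server needs -/
  need : Fin I → ℕ
  arr_pos : ∀ i, 0 < arr i
  srv_pos : ∀ i, 0 < srv i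
  need_pos : ∀ i, 0 < need i
  need_mono : Monotone need

namespace MSJSystem

variable {I : ℕ} (M : MSJSystem I)

/-- The total arrival rate. -/
def totalArr : ℝ := ∑ i, M.arr i

/-- The slack capacity of the whole system. -/
def slack : ℝ := M.servers - ∑ i, M.arr i * M.need i / M.srv i

/-- The work variability of the whole system. -/
def workVar : ℝ := ∑ i, M.arr i * (M.need i : ℝ) ^ 2 / M.srv i ^ 2

/-- The slack capacity of the `i`-th subsystem, which keeps the job types `j ≤ i`. -/
def subSlack (i : Fin I) : ℝ := M.servers - ∑ j ∈ Finset.Iic i, M.arr j * M.need j / M.srv j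

/-- The work variability of the `i`-th subsystem. -/
def subWorkVar (i : Fin I) : ℝ :=
  ∑ j ∈ Finset.Iic i, M.arr j * (M.need j : ℝ) ^ 2 / M.srv j ^ 2

/-- The maximal server need. -/
def maxNeed : ℕ := Finset.univ.sup M.need

/-- The minimal service rate. -/
def minSrv [NeZero I] : ℝ := Finset.univ.inf' Finset.univ_nonempty M.srv

end MSJSystem

/-- A scheduling policy for the system `M`, given by the continuous-time Markov chain that it
induces. The state space is countable and the transition rates are bounded. A state `s` determines
the list `jobs s` of jobs present, in order of arrival, each recorded with its type and with a flag
telling whether it is in service (`true`) or waiting in the queue (`false`); beyond this the state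
may hold arbitrary further memory of the policy. The set of jobs in service is chosen freely,
subject to the capacity constraint, and may be revised (preemption, randomization and resumption
included) at every arrival, at every departure and at internal transitions of the policy.

The rates of the chain are those of Poisson arrivals and exponential service: type `i` jobs arrive
at rate `M.arr i`, each type `i` job in service leaves at rate `M.srv i`, and the policy makes
an internal transition at rate `internalRate s`. -/
structure SchedPolicy {I : ℕ} (M : MSJSystem I) where
  State : Type
  countable_state : Countable State
  jobs : State → List (Fin I × Bool)
  capacity : ∀ s, ((jobs s).map fun j => if j.2 = true then M.need j.1 else 0).sum ≤ M.servers
  /-- law of the new state after the arrival of a type `i` job in state `s` -/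
  onArrival : State → Fin I → PMF State
  onArrival_types : ∀ s i s', onArrival s i s' ≠ 0 →
    (jobs s').map Prod.fst = (jobs s).map Prod.fst ++ [i]
  /-- law of the new state after the departure of the `k`-th job in state `s`; only relevant when
  this job is in service -/
  onDeparture : (s : State) → Fin (jobs s).length → PMF State
  onDeparture_types : ∀ s k s', ((jobs s).get k).2 = true → onDeparture s k s' ≠ 0 →
    (jobs s').map Prod.fst = ((jobs s).map Prod.fst).eraseIdx k
  /-- rate at which the policy changes its mind without arrival or departure -/
  internalRate : State → ℝ≥0
  internalRate_bdd : BddAbove (Set.range internalRate)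
  onInternal : State → PMF State
  onInternal_types : ∀ s s', onInternal s s' ≠ 0 →
    (jobs s').map Prod.fst = (jobs s).map Prod.fst

namespace SchedPolicy

variable {I : ℕ} {M : MSJSystem I} (P : SchedPolicy M)

/-- The events that can happen in state `s`: an arrival of some type, the departure of the job at
some position, or an internal transition of the policy. -/
abbrev Event (s : P.State) : Type := Fin I ⊕ Fin (P.jobs s).length ⊕ Unit

/-- The rate of each event in state `s`. -/
def rate (s : P.State) : P.Event s → ℝ≥0∞
  | .inl i => ENNReal.ofReal (M.arr i)
  | .inr (.inl k) =>
      if ((P.jobs s).get k).2 = true then ENNReal.ofReal (M.srv ((P.jobs s).get k).1) else 0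
  | .inr (.inr _) => P.internalRate s

/-- The law of the state after an event. -/
def next (s : P.State) : P.Event s → PMF P.State
  | .inl i => P.onArrival s i
  | .inr (.inl k) => P.onDeparture s k
  | .inr (.inr _) => P.onInternal s

/-- The total event rate in state `s`. -/
def totalRate (s : P.State) : ℝ≥0∞ := ∑' e, P.rate s e

/-- The rate at which the chain jumps from `s` to `s'`. (Events that leave the state
unchanged count as jumps from `s` to `s`; they do not matter in the balance equations.) -/
def jumpRate (s s' : P.State) : ℝ≥0∞ := ∑' e, P.rate s e * P.next s e s'

/-- `π` is a stationary distribution of the chain: the global balance equations hold. -/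
def IsStationary (π : PMF P.State) : Prop :=
  ∀ s', ∑' s, π s * P.jumpRate s s' = π s' * P.totalRate s'

lemma rate_ne_top (s : P.State) (e : P.Event s) : P.rate s e ≠ ∞ := by
  rcases e with i | k | u
  · exact ENNReal.ofReal_ne_top
  · simp only [rate]; split <;> simp
  · exact ENNReal.coe_ne_top

lemma totalRate_ne_top (s : P.State) : P.totalRate s ≠ ∞ := by
  rw [totalRate, tsum_fintype]
  exact ENNReal.sum_ne_top.2 fun e _ => P.rate_ne_top s e

lemma totalRate_ne_zero [NeZero I] (s : P.State) : P.totalRate s ≠ 0 := by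
  rw [totalRate, Ne, ENNReal.tsum_eq_zero]
  intro h
  have h0 := h (.inl 0)
  simp only [rate, ENNReal.ofReal_eq_zero] at h0
  exact absurd h0 (not_le.2 (M.arr_pos 0))

/-- The law of the first event in state `s`: probabilities proportional to the rates. -/
def firstEvent [NeZero I] (s : P.State) : PMF (P.Event s) :=
  PMF.normalize (P.rate s) (P.totalRate_ne_zero s) (P.totalRate_ne_top s)

/-- The chain together with one tagged job: `some (s, k)` means that the state is `s` and that the
tagged job is the one at position `k` of `jobs s`; `none` means that the tagged job has left. -/
abbrev Tagged : Type := Option (P.State × ℕ)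

instance : Countable P.Tagged :=
  haveI := P.countable_state
  inferInstanceAs (Countable (Option (P.State × ℕ)))

instance : MeasurableSpace P.Tagged := ⊤

instance : DiscreteMeasurableSpace P.Tagged := ⟨fun _ => trivial⟩

/-- The position after an event of the job that was at position `k` before (`none` if it left). -/
def moveTag (s : P.State) (k : ℕ) : P.Event s → Option ℕ
  | .inr (.inl j) => if (j : ℕ) < k then some (k - 1) else if (j : ℕ) = k then none else some k
  | _ => some k

/-- One step of the embedded jump chain of the chain with a tagged job. -/
def tagStep [NeZero I] : P.Tagged → PMF P.Tagged
  | none => PMF.pure none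
  | some (s, k) => (P.firstEvent s).bind fun e =>
      (P.next s e).map fun s' => (P.moveTag s k e).map fun k' => (s', k')

/-- `tagStep` as a Markov kernel. -/
def tagKernel [NeZero I] : Kernel P.Tagged P.Tagged :=
  Kernel.ofFunOfCountable fun t => (P.tagStep t).toMeasure

instance [NeZero I] : IsMarkovKernel P.tagKernel :=
  ⟨fun t => inferInstanceAs (IsProbabilityMeasure (P.tagStep t).toMeasure)⟩

/-- The law, in steady state `π`, of the state right after the arrival of a type `i` job, this job
being the tagged one. (Poisson arrivals see `π`; the new job is last in the list.) -/
def arrivalLaw (π : PMF P.State) (i : Fin I) : PMF P.Tagged :=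
  π.bind fun s => (P.onArrival s i).map fun s' => some (s', (P.jobs s).length)

/-- The law of the embedded jump chain from the arrival of a tagged type `i` job onwards. -/
def jumpChainLaw [NeZero I] (π : PMF P.State) (i : Fin I) : Measure (ℕ → P.Tagged) :=
  Kernel.trajMeasure (X := fun _ => P.Tagged) (P.arrivalLaw π i).toMeasure
    fun n => P.tagKernel.comap (fun h => h ⟨n, Finset.mem_Iic.2 le_rfl⟩) (measurable_pi_apply _)

/-- The jump-chain and holding-time construction: a path of the embedded jump chain together with
an independent sequence of independent exponential variables of mean one. -/
def pathLaw [NeZero I] (π : PMF P.State) (i : Fin I) :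
    Measure ((ℕ → P.Tagged) × (ℕ → ℝ)) :=
  (P.jumpChainLaw π i).prod (Measure.infinitePi fun _ => expMeasure 1)

open Classical in
/-- The waiting time accrued while the tagged chain stays in `t`, where `x` is the standard
exponential variable that produces the holding time `x / totalRate s`: the whole holding time if the
tagged job is waiting in the queue, and zero if it is in service or has left. -/
def waitIn : P.Tagged → ℝ → ℝ≥0∞
  | none, _ => 0
  | some (s, k), x =>
      if ∃ i, (P.jobs s)[k]? = some (i, false) then ENNReal.ofReal x / P.totalRate s else 0

/-- The waiting time of the tagged job along a path: the total time that it spends in the queue. -/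
def waitingTime (ω : (ℕ → P.Tagged) × (ℕ → ℝ)) : ℝ≥0∞ := ∑' m, P.waitIn (ω.1 m) (ω.2 m)

/-- The expected waiting time of type `i` jobs in the steady state `π`. -/
def meanWaitOfType [NeZero I] (π : PMF P.State) (i : Fin I) : ℝ≥0∞ :=
  ∫⁻ ω, P.waitingTime ω ∂(P.pathLaw π i)

/-- The mean waiting time in the steady state `π`: the average over the job types, weighted by the
arrival rates. -/
def meanWait [NeZero I] (π : PMF P.State) : ℝ≥0∞ :=
  (∑ i, ENNReal.ofReal (M.arr i) * P.meanWaitOfType π i) / ENNReal.ofReal M.totalArr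

end SchedPolicy

/-- Along a sequence of systems, the set of `i` for which the `i`-th subsystem is in heavy traffic,
that is, its slack capacity is of smaller order than the square root of its work variability divided
by `log n`. The critical index is the least element of this set. -/
def heavySubsystems {I : ℕ} (sys : ℕ → MSJSystem I) : Set (Fin I) :=
  {i | (fun n => (sys n).subSlack i) =o[atTop]
    fun n : ℕ => √((sys n).subWorkVar i) / Real.log n}

end

/-!
Fix one system and a policy in steady state. Two balance equations carry the proof. Let `L` count the
jobs present by type and `Z` those in service, and for a type `i` consider the work
`W = ∑ j ≤ i, (ℓ_j / μ_j) * L_j` and the number `U = n - ∑ j ≤ i, ℓ_j * Z_j` of servers that the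
types up to `i` leave idle. The balance of `L_j` gives `E Z_j = λ_j / μ_j`, hence `E U = δ_i`
(`IsSteadyCounts.integral_idle`), and the balance of `W ^ 2` gives `E[W * (δ_i - U)] = σ_i ^ 2`
(`IsSteadyCounts.integral_work_mul`). With `c = ∑ j ≤ i, (ℓ_j / μ_j) * (λ_j / μ_j)`, the mean work in
service, this reads
`δ_i * E[work in the queue] = σ_i ^ 2 - E[(c - W) * U]`.

The last term is negligible in heavy traffic. Since at most `L_j` jobs of type `j` are in service, the
generating function `φ` of `L_j` satisfies `φ' ≥ (λ_j / μ_j) φ`, so that `L_j` has a lower tail that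
is no heavier than that of a Poisson variable of mean `λ_j / μ_j`. Hence `c - W` exceeds `σ_i * log n`
(up to a constant) only with probability of order `1 / n`, while `U ≤ n` and `E U = δ_i`; this bounds
`E[(c - W) * U]` by a multiple of `σ_i * (δ_i * log n + 1)`, see
`IsSteadyCounts.integral_shortfall_mul_idle_le` and `IsSteadyCounts.le_subSlack_mul_queue_work`. A
job in the queue of the `i`-th subsystem carries mean work at most `ℓ_i / μ_min`, so a lower bound on
the number of jobs in the queue follows, and Little's law turns it into one on the waiting time.

Little's law needs care, since a policy may keep some jobs in the queue forever: these jobs are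
present in the stationary distribution but never arrive. The flow of jobs in steady state
(`stationaryFlow`) exceeds the flow of the jobs that have arrived at some time (`visitFlow`) by an
invariant flow (`ancientFlow`) of jobs that have been present forever. As a job moves towards the
front of the list one position at a time, and the flow through far positions is small, no job of the
ancient flow ever leaves (`tagStep_none_of_ancientFlow`). Jobs of the ancient flow are thus never in
service, and in steady state no job joins them, as their number cannot decrease
(`deadCount_next`). Removing them leaves counts that satisfy the same balance equations
(`liveCount_next`, `integral_generator`) and for which Little's law holds (`tsum_queueCount_le`).
-/

/-! ### The mean waiting time as a sum over the jumps -/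

lemma lintegral_ofReal_expMeasure_one : ∫⁻ x, ENNReal.ofReal x ∂(expMeasure 1) = 1 := by
  have hm : Measurable (exponentialPDF 1) :=
    (measurable_exponentialPDFReal 1).ennreal_ofReal
  have hd : expMeasure 1 = volume.withDensity (exponentialPDF 1) := rfl
  rw [hd, lintegral_withDensity_eq_lintegral_mul _ hm (by fun_prop)]
  have h0 : ∀ x : ℝ, (exponentialPDF 1 * fun x => ENNReal.ofReal x) x =
      (Set.Ioi (0 : ℝ)).indicator (fun x => ENNReal.ofReal (Real.exp (-x) * x ^ ((2 : ℝ) - 1))) x := by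
    intro x
    by_cases hx : 0 < x
    · rw [Set.indicator_of_mem (by exact hx)]
      simp only [Pi.mul_apply]
      rw [exponentialPDF_of_nonneg hx.le, ← ENNReal.ofReal_mul (by positivity)]
      norm_num
    · rw [Set.indicator_of_notMem (by exact hx)]
      simp [ENNReal.ofReal_of_nonpos (not_lt.1 hx)]
  simp_rw [h0]
  rw [lintegral_indicator measurableSet_Ioi,
    ← ofReal_integral_eq_lintegral_ofReal (Real.GammaIntegral_convergent (by norm_num : (0:ℝ) < 2))]
  · rw [← Real.Gamma_eq_integral (by norm_num : (0:ℝ) < 2)]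
    simp
  · filter_upwards [ae_restrict_mem measurableSet_Ioi] with x hx
    have : (0 : ℝ) < x := hx
    positivity

namespace SchedPolicy

variable {I : ℕ} {M : MSJSystem I} (P : SchedPolicy M)

/-- The law of the tagged jump chain after `m` jumps. -/
noncomputable def tagLaw [NeZero I] (π : PMF P.State) (i : Fin I) : ℕ → PMF P.Tagged
  | 0 => P.arrivalLaw π i
  | m + 1 => (tagLaw π i m).bind P.tagStep

/-- The mean waiting time accrued during one visit of the tagged chain to `t`. -/
noncomputable def waitCost : P.Tagged → ℝ≥0∞
  | none => 0
  | some (s, k) => if ∃ i, (P.jobs s)[k]? = some (i, false) then (P.totalRate s)⁻¹ else 0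

lemma map_eval_jumpChainLaw [NeZero I] (π : PMF P.State) (i : Fin I) (m : ℕ) :
    (P.jumpChainLaw π i).map (fun x => x m) = (P.tagLaw π i m).toMeasure := by
  have key : ∀ m, (P.jumpChainLaw π i).map (fun x => x (m + 1)) =
      P.tagKernel ∘ₘ ((P.jumpChainLaw π i).map (fun x => x m)) := by
    intro m
    have h := Kernel.map_frestrictLe_trajMeasure_compProd_eq_map_trajMeasure
      (X := fun _ => P.Tagged) (μ₀ := (P.arrivalLaw π i).toMeasure)
      (κ := fun n => P.tagKernel.comap (fun h => h ⟨n, Finset.mem_Iic.2 le_rfl⟩)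
        (measurable_pi_apply _)) (a := m)
    have h2 := congrArg (fun ν => ν.map Prod.snd) h
    change Measure.snd _ = _ at h2
    rw [Measure.snd_compProd, Measure.map_map (by fun_prop) (by fun_prop)] at h2
    rw [jumpChainLaw]
    refine (h2.symm.trans ?_)
    rw [← Kernel.comp_deterministic_eq_comap, ← Measure.comp_assoc,
      Measure.deterministic_comp_eq_map, Measure.map_map (by fun_prop) (by fun_prop)]
    rfl
  induction m with
  | zero =>
    have he : (fun x : ℕ → P.Tagged => x 0) =
        (fun y : (Finset.Iic 0 : Finset ℕ) → P.Tagged => y ⟨0, Finset.mem_Iic.2 le_rfl⟩) ∘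
          Preorder.frestrictLe 0 := rfl
    rw [jumpChainLaw, Kernel.trajMeasure, he, ← Measure.map_map (by fun_prop) (by fun_prop),
      Measure.map_comp _ _ (by fun_prop), Kernel.traj_map_frestrictLe, Kernel.partialTraj_self,
      Measure.id_comp, Measure.map_map (by fun_prop) (by fun_prop)]
    exact Measure.map_id
  | succ m ih =>
    rw [key, ih]
    refine Measure.ext_of_singleton fun t => ?_
    rw [Measure.bind_apply (measurableSet_singleton _) (by fun_prop), lintegral_countable',
      PMF.toMeasure_apply_singleton _ _ (measurableSet_singleton _), tagLaw, PMF.bind_apply]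
    refine tsum_congr fun t' => ?_
    rw [PMF.toMeasure_apply_singleton _ _ (measurableSet_singleton _), mul_comm]
    congr 1
    exact PMF.toMeasure_apply_singleton _ _ (measurableSet_singleton _)

lemma lintegral_waitIn (t : P.Tagged) :
    ∫⁻ x, P.waitIn t x ∂(expMeasure 1) = P.waitCost t := by
  rcases t with _ | ⟨s, k⟩
  · simp [waitIn, waitCost]
  · simp only [waitIn, waitCost]
    split_ifs
    · simp_rw [div_eq_mul_inv]
      rw [lintegral_mul_const _ (by fun_prop), lintegral_ofReal_expMeasure_one, one_mul]
    · simp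

lemma measurable_waitIn : Measurable fun p : P.Tagged × ℝ => P.waitIn p.1 p.2 := by
  refine measurable_from_prod_countable_right fun t => ?_
  rcases t with _ | ⟨s, k⟩
  · simp [waitIn]
  · simp only [waitIn]
    split_ifs <;> fun_prop

/-- The holding times are independent of the jump chain and have mean one before rescaling, so the
mean waiting time is the sum over all jumps of the mean cost of the state visited. -/
lemma meanWaitOfType_eq [NeZero I] (π : PMF P.State) (i : Fin I) :
    P.meanWaitOfType π i = ∑' m, ∑' t, P.tagLaw π i m t * P.waitCost t := by
  have hexp : IsProbabilityMeasure (expMeasure 1) := isProbabilityMeasure_expMeasure one_pos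
  have hjump : IsProbabilityMeasure (P.jumpChainLaw π i) := by
    rw [jumpChainLaw]; infer_instance
  have hmeas : ∀ m, Measurable fun ω : (ℕ → P.Tagged) × (ℕ → ℝ) => P.waitIn (ω.1 m) (ω.2 m) :=
    fun m => P.measurable_waitIn.comp
      (f := fun ω : (ℕ → P.Tagged) × (ℕ → ℝ) => (ω.1 m, ω.2 m)) (by fun_prop)
  rw [meanWaitOfType]
  simp only [waitingTime]
  rw [lintegral_tsum fun m => (hmeas m).aemeasurable]
  refine tsum_congr fun m => ?_
  rw [pathLaw, lintegral_prod _ (hmeas m).aemeasurable]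
  have hin : ∀ x : ℕ → P.Tagged, ∫⁻ y, P.waitIn (x m) (y m)
      ∂(Measure.infinitePi fun _ : ℕ => expMeasure 1) = P.waitCost (x m) := by
    intro x
    have hx : Measurable (P.waitIn (x m)) :=
      P.measurable_waitIn.comp (f := fun r : ℝ => (x m, r)) (by fun_prop)
    rw [← P.lintegral_waitIn]
    exact (measurePreserving_eval_infinitePi (fun _ => expMeasure 1) m).lintegral_comp hx
  simp only [hin]
  have hmap := lintegral_map (μ := P.jumpChainLaw π i) (f := P.waitCost) (g := fun x => x m)
    (Measurable.of_discrete) (by fun_prop)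
  rw [← hmap, P.map_eval_jumpChainLaw, lintegral_countable']
  refine tsum_congr fun t => ?_
  rw [PMF.toMeasure_apply_singleton _ _ (measurableSet_singleton _), mul_comm]

end SchedPolicy

/-! ### The tagged chain as a flow of jobs -/

lemma ENNReal.tsum_option {α : Type*} (f : Option α → ℝ≥0∞) : ∑' t, f t = f none + ∑' x, f (some x) := by
  rw [ENNReal.tsum_eq_add_tsum_ite none]
  congr 1
  refine ((Option.some_injective α).tsum_eq ?_).symm.trans ?_
  · intro t ht
    cases t <;> simp at ht ⊢
  · simp

namespace SchedPolicy

variable {I : ℕ} {M : MSJSystem I} (P : SchedPolicy M)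

lemma firstEvent_apply [NeZero I] (s : P.State) (e : P.Event s) :
    P.firstEvent s e = P.rate s e * (P.totalRate s)⁻¹ := rfl

lemma tagStep_some [NeZero I] (s : P.State) (k : ℕ) (s' : P.State) (k' : ℕ) :
    P.tagStep (some (s, k)) (some (s', k')) =
      ∑' e, P.firstEvent s e * if P.moveTag s k e = some k' then P.next s e s' else 0 := by
  simp only [tagStep, PMF.bind_apply]
  refine tsum_congr fun e => ?_
  congr 1
  rw [PMF.map_apply]
  rw [tsum_eq_single s']
  · rcases P.moveTag s k e with _ | j <;> simp [eq_comm]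
  · intro a ha
    rcases P.moveTag s k e with _ | j <;> simp [Ne.symm ha]

lemma tagStep_none [NeZero I] (s : P.State) (k : ℕ) :
    P.tagStep (some (s, k)) none =
      ∑' e, P.firstEvent s e * if P.moveTag s k e = none then 1 else 0 := by
  simp only [tagStep, PMF.bind_apply]
  refine tsum_congr fun e => ?_
  congr 1
  rw [PMF.map_apply]
  rcases P.moveTag s k e with _ | j <;> simp [PMF.tsum_coe]

lemma totalRate_mul_tagStep_some [NeZero I] (s : P.State) (k : ℕ) (s' : P.State) (k' : ℕ) :
    P.totalRate s * P.tagStep (some (s, k)) (some (s', k')) =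
      ∑' e, P.rate s e * if P.moveTag s k e = some k' then P.next s e s' else 0 := by
  rw [tagStep_some, ← ENNReal.tsum_mul_left]
  refine tsum_congr fun e => ?_
  rw [firstEvent_apply, ← mul_assoc, mul_comm (P.rate s e), ← mul_assoc,
    ENNReal.mul_inv_cancel (P.totalRate_ne_zero s) (P.totalRate_ne_top s), one_mul]

lemma tagStep_some_pos [NeZero I] {s s' : P.State} {k k' : ℕ} {e : P.Event s}
    (hr : P.rate s e ≠ 0) (hn : P.next s e s' ≠ 0) (hk : P.moveTag s k e = some k') :
    P.tagStep (some (s, k)) (some (s', k')) ≠ 0 := by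
  rw [tagStep_some]
  intro h
  have := ENNReal.tsum_eq_zero.1 h e
  rw [if_pos hk, firstEvent_apply] at this
  simp [hr, hn, P.totalRate_ne_top] at this

lemma tagStep_none_pos [NeZero I] {s : P.State} {k : ℕ} {e : P.Event s}
    (hr : P.rate s e ≠ 0) (hk : P.moveTag s k e = none) :
    P.tagStep (some (s, k)) none ≠ 0 := by
  rw [tagStep_none]
  intro h
  have := ENNReal.tsum_eq_zero.1 h e
  rw [if_pos hk, firstEvent_apply] at this
  simp [hr, P.totalRate_ne_top] at this

/-- The position of a job drops by at most one at each event. -/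
lemma le_of_moveTag {s : P.State} {k k' : ℕ} {e : P.Event s} (h : P.moveTag s k e = some k') :
    k ≤ k' + 1 := by
  rcases e with i | j | u
  · simp [moveTag] at h; omega
  · simp only [moveTag] at h; split_ifs at h <;> simp at h <;> omega
  · simp [moveTag] at h; omega

lemma tagStep_eq_zero_of_lt [NeZero I] {s s' : P.State} {k k' : ℕ} (h : k' + 1 < k) :
    P.tagStep (some (s, k)) (some (s', k')) = 0 := by
  rw [tagStep_some, ENNReal.tsum_eq_zero]
  intro e
  rw [if_neg, mul_zero]
  intro h'
  have := P.le_of_moveTag h'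
  omega

/-- The rate at which jobs of any type arrive and start at `x`. -/
noncomputable def arrivalFlow (π : PMF P.State) (x : P.State × ℕ) : ℝ≥0∞ :=
  ∑ i, ENNReal.ofReal (M.arr i) * P.arrivalLaw π i (some x)

/-- The rate of events at which a job is at position `x.2` of the state `x.1`. -/
noncomputable def stationaryFlow (π : PMF P.State) (x : P.State × ℕ) : ℝ≥0∞ :=
  if x.2 < (P.jobs x.1).length then π x.1 * P.totalRate x.1 else 0

lemma arrivalFlow_eq (π : PMF P.State) (s' : P.State) (k' : ℕ) :
    P.arrivalFlow π (s', k') = ∑' s, π s * ∑ i, ENNReal.ofReal (M.arr i) *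
      if (P.jobs s).length = k' then P.onArrival s i s' else 0 := by
  simp only [arrivalFlow, arrivalLaw, PMF.bind_apply, Finset.mul_sum]
  rw [Summable.tsum_finsetSum fun i _ => ENNReal.summable]
  refine Finset.sum_congr rfl fun i _ => ?_
  rw [← ENNReal.tsum_mul_left]
  refine tsum_congr fun s => ?_
  rw [← mul_assoc, ← mul_assoc, mul_comm (π s)]
  congr 1
  rw [PMF.map_apply, tsum_eq_single s']
  · simp [eq_comm]
  · intro a ha
    simp [Ne.symm ha]

lemma length_next {s s' : P.State} {e : P.Event s} (hr : P.rate s e ≠ 0)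
    (hn : P.next s e s' ≠ 0) : (P.jobs s').length = match e with
      | .inl _ => (P.jobs s).length + 1
      | .inr (.inl _) => (P.jobs s).length - 1
      | .inr (.inr _) => (P.jobs s).length := by
  rcases e with i | j | u
  · have := congrArg List.length (P.onArrival_types s i s' hn)
    simpa using this
  · have hb : ((P.jobs s).get j).2 = true := by
      by_contra hb
      simp [rate] at hr
      exact hb hr.1
    have := congrArg List.length (P.onDeparture_types s j s' hb hn)
    simpa [List.length_eraseIdx] using this
  · have := congrArg List.length (P.onInternal_types s s' hn)
    simpa using this

/-- After any event, each job present is either the one that has just arrived or was at exactly one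
position before the event. -/
lemma count_moveTag {s s' : P.State} {e : P.Event s} (hr : P.rate s e ≠ 0)
    (hn : P.next s e s' ≠ 0) (k' : ℕ) :
    (if e.isLeft ∧ (P.jobs s).length = k' then 1 else 0) +
      ∑' k, (if k < (P.jobs s).length ∧ P.moveTag s k e = some k' then 1 else 0) =
      if k' < (P.jobs s').length then (1 : ℝ≥0∞) else 0 := by
  have hl := P.length_next hr hn
  rcases e with i | j | u
  · simp only at hl
    rw [hl, tsum_eq_single k']
    · simp only [moveTag, Sum.isLeft_inl, true_and, and_true]
      split_ifs <;> first | omega | simp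
    · intro k hk
      simp [moveTag, hk]
  · have hj := j.2
    simp only at hl
    rw [hl, tsum_eq_single (if k' < j then k' else k' + 1)]
    · simp only [moveTag, Sum.isLeft_inr, Bool.false_eq_true, false_and, if_false, zero_add]
      congr 1
      rw [eq_iff_iff]
      split_ifs <;> simp <;> omega
    · intro k hk
      rw [if_neg]
      rintro ⟨-, h⟩
      apply hk
      simp only [moveTag] at h
      split_ifs at h ⊢ <;> simp at h <;> omega
  · simp only at hl
    rw [hl, tsum_eq_single k']
    · simp [moveTag]
    · intro k hk
      simp [moveTag, hk]

/-- Conservation of jobs in steady state: the flow of jobs through a position is the flow of new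
arrivals there plus the flow coming from other positions. -/
lemma stationaryFlow_eq [NeZero I] {π : PMF P.State} (hπ : P.IsStationary π)
    (x' : P.State × ℕ) :
    P.stationaryFlow π x' = P.arrivalFlow π x' +
      ∑' x, P.stationaryFlow π x * P.tagStep (some x) (some x') := by
  obtain ⟨s', k'⟩ := x'
  rw [arrivalFlow_eq, ENNReal.tsum_prod', ← ENNReal.tsum_add]
  have h1 : ∀ s, (∑' k, P.stationaryFlow π (s, k) * P.tagStep (some (s, k)) (some (s', k'))) =
      π s * ∑' e, P.rate s e * P.next s e s' *
        ∑' k, (if k < (P.jobs s).length ∧ P.moveTag s k e = some k' then 1 else 0) := by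
    intro s
    simp_rw [← ENNReal.tsum_mul_left]
    rw [ENNReal.tsum_comm]
    refine tsum_congr fun k => ?_
    simp only [stationaryFlow]
    split_ifs with hk
    · rw [mul_assoc, totalRate_mul_tagStep_some, ← ENNReal.tsum_mul_left]
      refine tsum_congr fun e => ?_
      by_cases h : P.moveTag s k e = some k' <;> simp [h, hk]
    · simp [hk]
  have h2 : ∀ s, (∑ i, ENNReal.ofReal (M.arr i) *
      if (P.jobs s).length = k' then P.onArrival s i s' else 0) =
      ∑' e : P.Event s, P.rate s e * P.next s e s' *
        (if e.isLeft ∧ (P.jobs s).length = k' then 1 else 0) := by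
    intro s
    rw [tsum_fintype, Fintype.sum_sum_type]
    simp [rate, next]
  have h3 : ∀ s, π s * (∑ i, ENNReal.ofReal (M.arr i) *
      if (P.jobs s).length = k' then P.onArrival s i s' else 0) +
      (∑' k, P.stationaryFlow π (s, k) * P.tagStep (some (s, k)) (some (s', k'))) =
      π s * P.jumpRate s s' * if k' < (P.jobs s').length then 1 else 0 := by
    intro s
    rw [h1, h2, ← mul_add, ← ENNReal.tsum_add, mul_assoc, jumpRate, ← ENNReal.tsum_mul_right]
    congr 1
    refine tsum_congr fun e => ?_
    rw [← mul_add]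
    by_cases hr : P.rate s e = 0
    · simp [hr]
    by_cases hn : P.next s e s' = 0
    · simp [hn]
    rw [P.count_moveTag hr hn]
  simp_rw [h3]
  rw [ENNReal.tsum_mul_right, hπ s']
  simp [stationaryFlow]

/-- The expected number of visits to `x` of jobs that have arrived at some time, per unit of time. -/
noncomputable def visitFlow [NeZero I] (π : PMF P.State) (x : P.State × ℕ) : ℝ≥0∞ :=
  ∑' m, ∑ i, ENNReal.ofReal (M.arr i) * P.tagLaw π i m (some x)

lemma tagLaw_succ_some [NeZero I] (π : PMF P.State) (i : Fin I) (m : ℕ) (x' : P.State × ℕ) :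
    P.tagLaw π i (m + 1) (some x') =
      ∑' x, P.tagLaw π i m (some x) * P.tagStep (some x) (some x') := by
  rw [tagLaw, PMF.bind_apply, ENNReal.tsum_option]
  simp [tagStep]

lemma sum_tagLaw_succ [NeZero I] (π : PMF P.State) (m : ℕ) (x' : P.State × ℕ) :
    ∑ i, ENNReal.ofReal (M.arr i) * P.tagLaw π i (m + 1) (some x') =
      ∑' x, (∑ i, ENNReal.ofReal (M.arr i) * P.tagLaw π i m (some x)) *
        P.tagStep (some x) (some x') := by
  simp_rw [Finset.sum_mul]
  rw [Summable.tsum_finsetSum fun i _ => ENNReal.summable]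
  refine Finset.sum_congr rfl fun i _ => ?_
  rw [tagLaw_succ_some, ← ENNReal.tsum_mul_left]
  simp_rw [mul_assoc]

lemma visitFlow_eq [NeZero I] (π : PMF P.State) (x' : P.State × ℕ) :
    P.visitFlow π x' = P.arrivalFlow π x' +
      ∑' x, P.visitFlow π x * P.tagStep (some x) (some x') := by
  rw [visitFlow, tsum_eq_zero_add' ENNReal.summable]
  congr 1
  simp_rw [sum_tagLaw_succ, visitFlow, ← ENNReal.tsum_mul_right]
  rw [ENNReal.tsum_comm]

lemma visitFlow_le [NeZero I] {π : PMF P.State} (hπ : P.IsStationary π) (x : P.State × ℕ) :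
    P.visitFlow π x ≤ P.stationaryFlow π x := by
  have key : ∀ m x, ∑ j ∈ Finset.range m,
      (∑ i, ENNReal.ofReal (M.arr i) * P.tagLaw π i j (some x)) ≤ P.stationaryFlow π x := by
    intro m
    induction m with
    | zero => simp
    | succ m ih =>
      intro x'
      rw [Finset.sum_range_succ', P.stationaryFlow_eq hπ, add_comm]
      refine add_le_add le_rfl ?_
      simp_rw [sum_tagLaw_succ]
      rw [← Summable.tsum_finsetSum fun i _ => ENNReal.summable]
      refine ENNReal.tsum_le_tsum fun x => ?_
      rw [← Finset.sum_mul]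
      exact mul_le_mul_left (ih x) _
  exact ENNReal.tsum_le_of_sum_range_le fun m => key m x

/-- The part of the stationary flow that is not accounted for by arrivals: the flow of jobs that
have been in the system forever. -/
noncomputable def ancientFlow [NeZero I] (π : PMF P.State) (x : P.State × ℕ) : ℝ≥0∞ :=
  P.stationaryFlow π x - P.visitFlow π x

lemma stationaryFlow_ne_top (π : PMF P.State) (x : P.State × ℕ) :
    P.stationaryFlow π x ≠ ∞ := by
  rw [stationaryFlow]
  split_ifs
  · exact ENNReal.mul_ne_top (PMF.apply_ne_top _ _) (P.totalRate_ne_top _)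
  · simp

lemma ancientFlow_le [NeZero I] (π : PMF P.State) (x : P.State × ℕ) :
    P.ancientFlow π x ≤ P.stationaryFlow π x := tsub_le_self

/-- The ancient flow is invariant for the tagged chain. -/
lemma ancientFlow_eq [NeZero I] {π : PMF P.State} (hπ : P.IsStationary π) (x' : P.State × ℕ) :
    P.ancientFlow π x' = ∑' x, P.ancientFlow π x * P.tagStep (some x) (some x') := by
  have hadd : ∀ x, P.ancientFlow π x + P.visitFlow π x = P.stationaryFlow π x :=
    fun x => tsub_add_cancel_of_le (P.visitFlow_le hπ x)
  have hne : P.visitFlow π x' ≠ ∞ :=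
    ne_top_of_le_ne_top (P.stationaryFlow_ne_top π x') (P.visitFlow_le hπ x')
  refine (ENNReal.add_left_inj hne).1 ?_
  rw [hadd, P.stationaryFlow_eq hπ, P.visitFlow_eq, add_left_comm, ← ENNReal.tsum_add]
  simp_rw [← hadd, add_mul]

/-! ### Bounded rates and the balance equations -/

/-- The number of type `j` jobs in service. -/
def serviceCount (s : P.State) (j : Fin I) : ℕ :=
  ((Finset.range (P.jobs s).length).filter fun k => (P.jobs s)[k]? = some (j, true)).card

lemma sum_rate_departure (s : P.State) (f : Fin I → ℝ≥0∞) :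
    ∑ k : Fin (P.jobs s).length, P.rate s (.inr (.inl k)) * f ((P.jobs s).get k).1 =
      ∑ j, ENNReal.ofReal (M.srv j) * P.serviceCount s j * f j := by
  have h1 : ∀ k : Fin (P.jobs s).length, P.rate s (.inr (.inl k)) * f ((P.jobs s).get k).1 =
      ∑ j, if (P.jobs s)[(k : ℕ)]? = some (j, true) then ENNReal.ofReal (M.srv j) * f j else 0 := by
    intro k
    rw [List.getElem?_eq_getElem k.2, Finset.sum_eq_single ((P.jobs s).get k).1]
    · by_cases h : ((P.jobs s).get k).2 = true
      · simp only [rate, h, if_true]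
        rw [if_pos]
        rw [← h]; rfl
      · rw [if_neg]
        · simp only [rate, if_neg h, zero_mul]
        · intro h'
          exact h (congrArg Prod.snd (Option.some.inj h'))
    · intro j _ hj
      rw [if_neg]
      intro h'
      apply hj
      exact (congrArg Prod.fst (Option.some.inj h')).symm
    · simp
  simp_rw [h1]
  rw [Finset.sum_comm]
  refine Finset.sum_congr rfl fun j _ => ?_
  rw [Fin.sum_univ_eq_sum_range (fun k => if (P.jobs s)[k]? = some (j, true) then
    ENNReal.ofReal (M.srv j) * f j else 0), ← Finset.sum_filter, Finset.sum_const, serviceCount,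
    nsmul_eq_mul]
  ring

lemma sum_need_mul_serviceCount_le (s : P.State) :
    ∑ j, M.need j * P.serviceCount s j ≤ M.servers := by
  refine le_trans (le_of_eq ?_) (P.capacity s)
  rw [← Fin.sum_univ_fun_getElem]
  have h1 : ∀ k : Fin (P.jobs s).length,
      (if ((P.jobs s)[(k : ℕ)]).2 = true then M.need ((P.jobs s)[(k : ℕ)]).1 else 0) =
      ∑ j, if (P.jobs s)[(k : ℕ)]? = some (j, true) then M.need j else 0 := by
    intro k
    rw [List.getElem?_eq_getElem k.2, Finset.sum_eq_single ((P.jobs s)[(k : ℕ)]).1]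
    · congr 1
      rw [eq_iff_iff, Option.some.injEq, Prod.ext_iff]
      simp
    · intro j _ hj
      rw [if_neg]
      intro h'
      apply hj
      exact (congrArg Prod.fst (Option.some.inj h')).symm
    · simp
  simp_rw [h1]
  rw [Finset.sum_comm]
  refine Finset.sum_congr rfl fun j _ => ?_
  rw [Fin.sum_univ_eq_sum_range (fun k => if (P.jobs s)[k]? = some (j, true) then
    M.need j else 0), ← Finset.sum_filter, Finset.sum_const, serviceCount, smul_eq_mul, mul_comm]

lemma serviceCount_le (s : P.State) (j : Fin I) : P.serviceCount s j ≤ M.servers :=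
  calc P.serviceCount s j ≤ M.need j * P.serviceCount s j :=
        Nat.le_mul_of_pos_left _ (M.need_pos j)
    _ ≤ ∑ j, M.need j * P.serviceCount s j :=
        Finset.single_le_sum (f := fun j => M.need j * P.serviceCount s j)
          (fun _ _ => Nat.zero_le _) (Finset.mem_univ j)
    _ ≤ _ := P.sum_need_mul_serviceCount_le s

lemma totalRate_eq (s : P.State) : P.totalRate s = ∑ i, ENNReal.ofReal (M.arr i) +
    (∑ j, ENNReal.ofReal (M.srv j) * P.serviceCount s j + P.internalRate s) := by
  have := P.sum_rate_departure s fun _ => 1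
  simp only [mul_one] at this
  rw [totalRate, tsum_fintype, Fintype.sum_sum_type, Fintype.sum_sum_type, this]
  simp [rate]

lemma exists_totalRate_le : ∃ C : ℝ≥0∞, C ≠ ∞ ∧ ∀ s, P.totalRate s ≤ C := by
  obtain ⟨b, hb⟩ := P.internalRate_bdd
  refine ⟨∑ i, ENNReal.ofReal (M.arr i) +
    (∑ j, ENNReal.ofReal (M.srv j) * M.servers + b), ?_, fun s => ?_⟩
  · refine ENNReal.add_ne_top.2 ⟨?_, ENNReal.add_ne_top.2 ⟨?_, ENNReal.coe_ne_top⟩⟩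
    · exact ENNReal.sum_ne_top.2 fun i _ => ENNReal.ofReal_ne_top
    · exact ENNReal.sum_ne_top.2 fun i _ =>
        ENNReal.mul_ne_top ENNReal.ofReal_ne_top (ENNReal.natCast_ne_top _)
  · rw [totalRate_eq]
    gcongr with j
    · exact P.serviceCount_le s j
    · exact hb ⟨s, rfl⟩

lemma tsum_balance {π : PMF P.State} (hπ : P.IsStationary π) (f : P.State → ℝ≥0∞) :
    ∑' s, π s * ∑' e, P.rate s e * ∑' s', P.next s e s' * f s' =
      ∑' s, π s * P.totalRate s * f s := by
  simp_rw [← hπ _, ← ENNReal.tsum_mul_right]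
  rw [ENNReal.tsum_comm]
  refine tsum_congr fun s => ?_
  simp_rw [mul_assoc]
  rw [ENNReal.tsum_mul_left]
  congr 1
  simp_rw [jumpRate, ← ENNReal.tsum_mul_right, ← ENNReal.tsum_mul_left]
  rw [ENNReal.tsum_comm]
  simp_rw [mul_assoc]

lemma tsum_balance_self (π : PMF P.State) (f : P.State → ℝ≥0∞) :
    ∑' s, π s * ∑' e, P.rate s e * ∑' s', P.next s e s' * f s =
      ∑' s, π s * P.totalRate s * f s := by
  refine tsum_congr fun s => ?_
  simp_rw [ENNReal.tsum_mul_right, PMF.tsum_coe, one_mul]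
  rw [ENNReal.tsum_mul_right, totalRate, mul_assoc]

lemma tsum_balance_ne_top (π : PMF P.State) {f : P.State → ℝ≥0∞} {B : ℝ≥0∞} (hB : B ≠ ∞)
    (hf : ∀ s, f s ≤ B) : ∑' s, π s * P.totalRate s * f s ≠ ∞ := by
  obtain ⟨C, hC, hle⟩ := P.exists_totalRate_le
  refine ne_top_of_le_ne_top (b := ∑' s, π s * (C * B)) ?_ ?_
  · rw [ENNReal.tsum_mul_right, PMF.tsum_coe, one_mul]
    exact ENNReal.mul_ne_top hC hB
  · refine ENNReal.tsum_le_tsum fun s => ?_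
    rw [mul_assoc]
    gcongr
    exacts [hle s, hf s]

/-- In steady state, a bounded function of the state that never decreases is constant along all
transitions. -/
lemma le_of_monotone_along {π : PMF P.State} (hπ : P.IsStationary π) {f : P.State → ℝ≥0∞}
    {B : ℝ≥0∞} (hB : B ≠ ∞) (hf : ∀ s, f s ≤ B)
    (hmono : ∀ s e s', P.rate s e ≠ 0 → P.next s e s' ≠ 0 → f s ≤ f s')
    {s s' : P.State} {e : P.Event s} (hs : π s ≠ 0) (hr : P.rate s e ≠ 0)
    (hn : P.next s e s' ≠ 0) : f s' ≤ f s := by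
  have h1 : ∑' s, π s * ∑' e, P.rate s e * ∑' s', P.next s e s' * f s' =
      ∑' s, π s * (∑' e, P.rate s e * ∑' s', P.next s e s' * f s) +
      ∑' s, π s * (∑' e, P.rate s e * ∑' s', P.next s e s' * (f s' - f s)) := by
    rw [← ENNReal.tsum_add]
    refine tsum_congr fun s => ?_
    rw [← mul_add, ← ENNReal.tsum_add]
    congr 1
    refine tsum_congr fun e => ?_
    rw [← mul_add, ← ENNReal.tsum_add]
    by_cases hr : P.rate s e = 0
    · simp [hr]
    congr 1
    refine tsum_congr fun s' => ?_
    by_cases hn : P.next s e s' = 0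
    · simp [hn]
    rw [← mul_add, add_tsub_cancel_of_le (hmono s e s' hr hn)]
  rw [P.tsum_balance hπ, P.tsum_balance_self] at h1
  have h2 := (ENNReal.add_right_inj (P.tsum_balance_ne_top π hB hf)).1 (h1.symm.trans (add_zero _).symm)
  have h3 := ENNReal.tsum_eq_zero.1 h2 s
  have h4 := ENNReal.tsum_eq_zero.1 ((mul_eq_zero.1 h3).resolve_left hs) e
  have h5 := ENNReal.tsum_eq_zero.1 ((mul_eq_zero.1 h4).resolve_left hr) s'
  exact tsub_eq_zero_iff_le.1 ((mul_eq_zero.1 h5).resolve_left hn)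

/-! ### Jobs that never leave -/

instance : MeasurableSpace P.State := ⊤

instance : DiscreteMeasurableSpace P.State := ⟨fun _ => trivial⟩

lemma tendsto_tsum_stationaryFlow (π : PMF P.State) :
    Tendsto (fun K => ∑' s, P.stationaryFlow π (s, K)) atTop (𝓝 0) := by
  have := P.countable_state
  obtain ⟨C, hC, hle⟩ := P.exists_totalRate_le
  have h := tendsto_lintegral_of_dominated_convergence (μ := Measure.count)
    (F := fun K s => P.stationaryFlow π (s, K)) (f := fun _ => 0) (fun s => π s * C)
    (fun K => Measurable.of_discrete) (fun K => .of_forall fun s => ?_) ?_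
    (.of_forall fun s => ?_)
  · simpa [lintegral_count] using h
  · simp only [stationaryFlow]
    split_ifs
    · gcongr; exact hle s
    · exact zero_le
  · rw [lintegral_count, ENNReal.tsum_mul_right, PMF.tsum_coe, one_mul]
    exact hC
  · refine tendsto_const_nhds.congr' ?_
    filter_upwards [eventually_ge_atTop (P.jobs s).length] with K hK
    simp [stationaryFlow, hK]

lemma tsum_stationaryFlow_ne_top (π : PMF P.State) (k : ℕ) :
    ∑' s, P.stationaryFlow π (s, k) ≠ ∞ := by
  refine ne_top_of_le_ne_top (P.tsum_balance_ne_top π (f := fun _ => 1) ENNReal.one_ne_top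
    fun _ => le_rfl) (ENNReal.tsum_le_tsum fun s => ?_)
  simp only [stationaryFlow]
  split_ifs <;> simp

lemma tsum_tagStep_add_none [NeZero I] (x : P.State × ℕ) :
    P.tagStep (some x) none + ∑' x', P.tagStep (some x) (some x') = 1 := by
  rw [← ENNReal.tsum_option, PMF.tsum_coe]

/-- A job in the ancient flow never leaves. Indeed the ancient flow through the first `K` positions
loses the jobs that leave, and is replenished only through position `K + 1`; the latter flow
vanishes as `K` grows. -/
lemma tagStep_none_of_ancientFlow [NeZero I] {π : PMF P.State} (hπ : P.IsStationary π)
    {x : P.State × ℕ} (hx : P.ancientFlow π x ≠ 0) : P.tagStep (some x) none = 0 := by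
  classical
  have hfin : ∀ K : ℕ, ∑' x, (if x.2 ≤ K then P.ancientFlow π x else 0) ≠ ∞ := by
    intro K
    rw [ENNReal.tsum_prod', ENNReal.tsum_comm,
      tsum_eq_sum (s := Finset.range (K + 1))]
    · refine ENNReal.sum_ne_top.2 fun k hk => ?_
      refine ne_top_of_le_ne_top (P.tsum_stationaryFlow_ne_top π k)
        (ENNReal.tsum_le_tsum fun s => ?_)
      split_ifs
      · exact P.ancientFlow_le π _
      · exact zero_le
    · intro k hk
      simp only [Finset.mem_range, not_lt] at hk
      simp [show ¬ k ≤ K by omega]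
  have key : ∀ K : ℕ, x.2 ≤ K → P.ancientFlow π x * P.tagStep (some x) none ≤
      ∑' s, P.stationaryFlow π (s, K + 1) := by
    intro K hK
    have hout : ∀ y : P.State × ℕ, (∑' x' : P.State × ℕ, if x'.2 ≤ K then
        P.ancientFlow π y * P.tagStep (some y) (some x') else 0) +
        (if y.2 ≤ K then P.ancientFlow π y * P.tagStep (some y) none else 0) ≤
        (if y.2 ≤ K then P.ancientFlow π y else 0) +
        if y.2 = K + 1 then P.ancientFlow π y else 0 := by
      intro y
      have hle : (∑' x' : P.State × ℕ, if x'.2 ≤ K then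
          P.ancientFlow π y * P.tagStep (some y) (some x') else 0) +
          P.ancientFlow π y * P.tagStep (some y) none ≤ P.ancientFlow π y := by
        calc _ ≤ ∑' x' : P.State × ℕ, P.ancientFlow π y * P.tagStep (some y) (some x') +
                P.ancientFlow π y * P.tagStep (some y) none := by
              gcongr
              split_ifs <;> simp
          _ = P.ancientFlow π y := by
              rw [ENNReal.tsum_mul_left, ← mul_add, add_comm, P.tsum_tagStep_add_none, mul_one]
      rcases lt_trichotomy y.2 (K + 1) with h | h | h
      · have h' : y.2 ≤ K := by omega
        simp only [h', if_true, h.ne, if_false, add_zero]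
        exact hle
      · have h' : ¬ y.2 ≤ K := by omega
        rw [if_neg h', if_neg h', if_pos h, add_zero, zero_add]
        exact le_self_add.trans hle
      · have h' : ¬ y.2 ≤ K := by omega
        simp only [h', if_false, h.ne', add_zero]
        refine (ENNReal.tsum_eq_zero.2 fun x' => ?_).le
        split_ifs with hx'
        · obtain ⟨s, k⟩ := y
          obtain ⟨s', k'⟩ := x'
          rw [P.tagStep_eq_zero_of_lt (by simp only at *; omega), mul_zero]
        · rfl
    have hsum := ENNReal.tsum_le_tsum hout
    rw [ENNReal.tsum_add, ENNReal.tsum_add, ENNReal.tsum_comm] at hsum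
    have hin : (∑' x' : P.State × ℕ, ∑' y : P.State × ℕ, if x'.2 ≤ K then
        P.ancientFlow π y * P.tagStep (some y) (some x') else 0) =
        ∑' x : P.State × ℕ, if x.2 ≤ K then P.ancientFlow π x else 0 := by
      refine tsum_congr fun x' => ?_
      split_ifs
      · exact (P.ancientFlow_eq hπ x').symm
      · simp
    rw [hin] at hsum
    have hsum' := (ENNReal.add_le_add_iff_left (hfin K)).1 hsum
    refine le_trans ?_ (hsum'.trans ?_)
    · refine le_trans (le_of_eq ?_) (ENNReal.le_tsum x)
      rw [if_pos hK]
    · rw [ENNReal.tsum_prod']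
      refine ENNReal.tsum_le_tsum fun s => ?_
      rw [tsum_eq_single (K + 1)]
      · simpa using P.ancientFlow_le π _
      · intro k hk
        simp [hk]
  have hlim := (P.tendsto_tsum_stationaryFlow π).comp (tendsto_add_atTop_nat 1)
  have h0 : P.ancientFlow π x * P.tagStep (some x) none ≤ 0 :=
    ge_of_tendsto hlim (eventually_atTop.2 ⟨x.2, fun K hK => key K hK⟩)
  exact (mul_eq_zero.1 (nonpos_iff_eq_zero.1 h0)).resolve_left hx

lemma ancientFlow_next [NeZero I] {π : PMF P.State} (hπ : P.IsStationary π) {s s' : P.State}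
    {k : ℕ} {e : P.Event s} (hk : P.ancientFlow π (s, k) ≠ 0) (hr : P.rate s e ≠ 0)
    (hn : P.next s e s' ≠ 0) :
    ∃ k', P.moveTag s k e = some k' ∧ P.ancientFlow π (s', k') ≠ 0 := by
  rcases h : P.moveTag s k e with _ | k'
  · exact absurd (P.tagStep_none_of_ancientFlow hπ hk) (P.tagStep_none_pos hr h)
  · refine ⟨k', rfl, fun h0 => ?_⟩
    rw [P.ancientFlow_eq hπ, ENNReal.tsum_eq_zero] at h0
    exact (mul_ne_zero hk (P.tagStep_some_pos hr hn h)) (h0 (s, k))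

end SchedPolicy

lemma List.count_eq_card_filter_range {α : Type*} [DecidableEq α] (l : List α) (a : α) :
    l.count a = ((Finset.range l.length).filter fun k => l[k]? = some a).card := by
  induction l using List.reverseRecOn with
  | nil => simp
  | append_singleton l x ih =>
    have h : ((Finset.range l.length).filter fun k => (l ++ [x])[k]? = some a) =
        (Finset.range l.length).filter fun k => l[k]? = some a := by
      refine Finset.filter_congr fun k hk => ?_
      rw [List.getElem?_append_left (Finset.mem_range.1 hk)]
    rw [List.count_append, ih, List.length_append, List.length_singleton, Finset.range_add_one,
      Finset.filter_insert, h, List.getElem?_append_right le_rfl]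
    by_cases hx : x = a
    · simp [hx]
    · simp [hx]

namespace SchedPolicy

variable {I : ℕ} {M : MSJSystem I} (P : SchedPolicy M)

/-! ### The live jobs -/

/-- The types of the jobs present, in order of arrival. -/
def types (s : P.State) : List (Fin I) := (P.jobs s).map Prod.fst

lemma length_types (s : P.State) : (P.types s).length = (P.jobs s).length := by simp [types]

lemma inService_of_rate {s : P.State} {j : Fin (P.jobs s).length}
    (hr : P.rate s (.inr (.inl j)) ≠ 0) : ((P.jobs s).get j).2 = true := by
  by_contra hb
  simp only [rate, if_neg hb] at hr
  exact hr rfl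

/-- Events do not change the type of a job that stays. -/
lemma types_moveTag {s s' : P.State} {k k' : ℕ} {e : P.Event s} (hr : P.rate s e ≠ 0)
    (hn : P.next s e s' ≠ 0) (hk : P.moveTag s k e = some k') (hlt : k < (P.jobs s).length) :
    (P.types s')[k']? = (P.types s)[k]? := by
  rcases e with i | j | u
  · have h := P.onArrival_types s i s' hn
    simp only [moveTag, Option.some.injEq] at hk
    rw [types, h, ← hk, List.getElem?_append_left (by simpa using hlt)]
    rfl
  · have h := P.onDeparture_types s j s' (P.inService_of_rate hr) hn
    rw [types, h, List.getElem?_eraseIdx]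
    simp only [moveTag] at hk
    split_ifs at hk ⊢ <;> simp only [Option.some.injEq] at hk
    · omega
    · rw [← hk]; rfl
    · rw [← hk, Nat.sub_add_cancel (by omega)]; rfl
    · omega
  · have h := P.onInternal_types s s' hn
    simp only [moveTag, Option.some.injEq] at hk
    rw [types, h, ← hk]
    rfl

/-- The number of type `j` jobs that belong to the ancient flow. They never leave. -/
noncomputable def deadCount [NeZero I] (π : PMF P.State) (s : P.State) (j : Fin I) : ℕ :=
  ((Finset.range (P.jobs s).length).filter fun k =>
    (P.types s)[k]? = some j ∧ P.ancientFlow π (s, k) ≠ 0).card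

/-- The number of type `j` jobs present that do not belong to the ancient flow. -/
noncomputable def liveCount [NeZero I] (π : PMF P.State) (s : P.State) (j : Fin I) : ℕ :=
  ((Finset.range (P.jobs s).length).filter fun k =>
    (P.types s)[k]? = some j ∧ P.ancientFlow π (s, k) = 0).card

/-- The number of type `j` jobs in the queue that do not belong to the ancient flow. -/
noncomputable def queueCount [NeZero I] (π : PMF P.State) (s : P.State) (j : Fin I) : ℕ :=
  ((Finset.range (P.jobs s).length).filter fun k =>
    (P.jobs s)[k]? = some (j, false) ∧ P.ancientFlow π (s, k) = 0).card

lemma liveCount_add_deadCount [NeZero I] (π : PMF P.State) (s : P.State) (j : Fin I) :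
    P.liveCount π s j + P.deadCount π s j = (P.types s).count j := by
  classical
  rw [List.count_eq_card_filter_range, length_types, liveCount, deadCount,
    ← Finset.card_filter_add_card_filter_not (s := (Finset.range (P.jobs s).length).filter
      fun k => (P.types s)[k]? = some j) (fun k => P.ancientFlow π (s, k) = 0),
    Finset.filter_filter, Finset.filter_filter]

lemma serviceCount_add_queueCount [NeZero I] {π : PMF P.State} (hπ : P.IsStationary π)
    (s : P.State) (j : Fin I) :
    P.serviceCount s j + P.queueCount π s j = P.liveCount π s j := by
  classical
  rw [liveCount, serviceCount, queueCount, ← Finset.card_union_of_disjoint]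
  · congr 1
    ext k
    simp only [Finset.mem_union, Finset.mem_filter, Finset.mem_range, types, List.getElem?_map]
    constructor
    · rintro (⟨hk, h⟩ | ⟨hk, h, h'⟩)
      · refine ⟨hk, by simp [h], ?_⟩
        by_contra hne
        have hget : (P.jobs s).get ⟨k, hk⟩ = (j, true) := by
          rw [List.getElem?_eq_getElem hk] at h
          exact Option.some.inj h
        refine P.tagStep_none_pos (e := .inr (.inl ⟨k, hk⟩)) ?_ ?_
          (P.tagStep_none_of_ancientFlow hπ hne)
        · simp only [rate, hget, if_true]
          simpa using M.srv_pos j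
        · simp [moveTag]
      · exact ⟨hk, by simp [h], h'⟩
    · rintro ⟨hk, h, h'⟩
      rw [Option.map_eq_some_iff] at h
      obtain ⟨⟨j', b⟩, hjb, rfl⟩ := h
      cases b
      · exact Or.inr ⟨hk, hjb, h'⟩
      · exact Or.inl ⟨hk, hjb⟩
  · rw [Finset.disjoint_filter]
    intro k _ h1 h2
    rw [h1] at h2
    simp at h2

lemma moveTag_injective {s : P.State} {e : P.Event s} {k₁ k₂ k' : ℕ}
    (h₁ : P.moveTag s k₁ e = some k') (h₂ : P.moveTag s k₂ e = some k') : k₁ = k₂ := by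
  rcases e with i | j | u
  · simp only [moveTag, Option.some.injEq] at h₁ h₂; omega
  · simp only [moveTag] at h₁ h₂
    split_ifs at h₁ h₂ <;> simp only [Option.some.injEq] at h₁ h₂ <;> omega
  · simp only [moveTag, Option.some.injEq] at h₁ h₂; omega

lemma lt_length_of_ancientFlow [NeZero I] {π : PMF P.State} {s : P.State} {k : ℕ}
    (h : P.ancientFlow π (s, k) ≠ 0) : π s ≠ 0 ∧ k < (P.jobs s).length := by
  have h' : P.stationaryFlow π (s, k) ≠ 0 := fun h0 =>
    h (nonpos_iff_eq_zero.1 (h0 ▸ P.ancientFlow_le π (s, k)))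
  simp only [stationaryFlow] at h'
  split_ifs at h' with hk
  · exact ⟨left_ne_zero_of_mul h', hk⟩
  · exact absurd rfl h'

lemma deadCount_le [NeZero I] {π : PMF P.State} (hπ : P.IsStationary π) (j : Fin I)
    {s s' : P.State} {e : P.Event s} (hr : P.rate s e ≠ 0) (hn : P.next s e s' ≠ 0) :
    P.deadCount π s j ≤ P.deadCount π s' j := by
  classical
  refine Finset.card_le_card_of_injOn (fun k => (P.moveTag s k e).getD 0) ?_ ?_
  · intro k hk
    simp only [Finset.coe_filter, Finset.mem_range, Set.mem_ofPred_eq] at hk ⊢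
    obtain ⟨hlt, ht, ha⟩ := hk
    obtain ⟨k', hk', ha'⟩ := P.ancientFlow_next hπ ha hr hn
    rw [hk', Option.getD_some]
    exact ⟨(P.lt_length_of_ancientFlow ha').2, (P.types_moveTag hr hn hk' hlt).trans ht, ha'⟩
  · intro k₁ h₁ k₂ h₂ h
    simp only [Finset.coe_filter, Finset.mem_range, Set.mem_ofPred_eq] at h₁ h₂
    obtain ⟨k₁', hk₁, -⟩ := P.ancientFlow_next hπ h₁.2.2 hr hn
    obtain ⟨k₂', hk₂, -⟩ := P.ancientFlow_next hπ h₂.2.2 hr hn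
    simp only [hk₁, hk₂, Option.getD_some] at h
    exact P.moveTag_injective (hk₁.trans (by rw [h])) hk₂

/-- In steady state no job joins the ancient flow, since the number of jobs in it never
decreases. -/
lemma deadCount_next [NeZero I] {π : PMF P.State} (hπ : P.IsStationary π) (j : Fin I)
    {s s' : P.State} {e : P.Event s} (hs : π s ≠ 0) (hr : P.rate s e ≠ 0)
    (hn : P.next s e s' ≠ 0) : P.deadCount π s' j = P.deadCount π s j := by
  refine le_antisymm ?_ (P.deadCount_le hπ j hr hn)
  -- truncation makes the count bounded; the cut-off is above its value at `s'`
  have h := P.le_of_monotone_along hπ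
    (f := fun t => ((min (P.deadCount π t j) (P.deadCount π s' j) : ℕ) : ℝ≥0∞))
    (B := (P.deadCount π s' j : ℕ)) (ENNReal.natCast_ne_top _)
    (fun t => by exact_mod_cast min_le_right _ _)
    (fun t e t' hr hn => by
      have := P.deadCount_le hπ j hr hn
      exact_mod_cast min_le_min_right _ this) hs hr hn
  have h' : min (P.deadCount π s' j) (P.deadCount π s' j) ≤
    min (P.deadCount π s j) (P.deadCount π s' j) := by exact_mod_cast h
  simpa using h'

lemma count_types_next {s s' : P.State} {e : P.Event s} (hr : P.rate s e ≠ 0)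
    (hn : P.next s e s' ≠ 0) (j : Fin I) : match e with
      | .inl i => (P.types s').count j = (P.types s).count j + (Pi.single i 1 : Fin I → ℕ) j
      | .inr (.inl k) => (P.types s').count j + (Pi.single ((P.jobs s).get k).1 1 : Fin I → ℕ) j =
          (P.types s).count j
      | .inr (.inr _) => (P.types s').count j = (P.types s).count j := by
  rcases e with i | k | u
  · have h := P.onArrival_types s i s' hn
    simp only [types, h, List.count_append, List.count_singleton, Pi.single_apply, beq_iff_eq,
      eq_comm (a := i)]
  · have h := P.onDeparture_types s k s' (P.inService_of_rate hr) hn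
    have hk : (k : ℕ) < ((P.jobs s).map Prod.fst).length := by simp
    have hp := (List.getElem_cons_eraseIdx_perm hk).count_eq j
    simp only [types, h]
    rw [← hp, List.count_cons, Pi.single_apply]
    simp only [List.getElem_map, List.get_eq_getElem, beq_iff_eq, eq_comm (a := j)]
  · have h := P.onInternal_types s s' hn
    simp only [types, h]

/-- The job counts after an event in state `s`, if they are `x` before it. -/
def countAfter (s : P.State) (x : Fin I → ℕ) : P.Event s → Fin I → ℕ
  | .inl i => x + Pi.single i 1
  | .inr (.inl k) => x - Pi.single ((P.jobs s).get k).1 1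
  | .inr (.inr _) => x

/-- In steady state the live job counts change only by arrivals and departures. -/
lemma liveCount_next [NeZero I] {π : PMF P.State} (hπ : P.IsStationary π)
    {s s' : P.State} {e : P.Event s} (hs : π s ≠ 0) (hr : P.rate s e ≠ 0)
    (hn : P.next s e s' ≠ 0) : P.liveCount π s' = P.countAfter s (P.liveCount π s) e := by
  funext j
  have h1 := P.liveCount_add_deadCount π s j
  have h2 := P.liveCount_add_deadCount π s' j
  have h3 := P.deadCount_next hπ j hs hr hn
  have h4 := P.count_types_next hr hn j
  rcases e with i | k | u <;> simp only [countAfter, Pi.add_apply, Pi.sub_apply] at h4 ⊢ <;> omega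

lemma tsum_balance_liveCount [NeZero I] {π : PMF P.State} (hπ : P.IsStationary π)
    (F : (Fin I → ℕ) → ℝ≥0∞) :
    ∑' s, π s * (∑ i, ENNReal.ofReal (M.arr i) * F (P.liveCount π s + Pi.single i 1) +
      (∑ j, ENNReal.ofReal (M.srv j) * P.serviceCount s j * F (P.liveCount π s - Pi.single j 1) +
      P.internalRate s * F (P.liveCount π s))) =
    ∑' s, π s * (∑ i, ENNReal.ofReal (M.arr i) * F (P.liveCount π s) +
      (∑ j, ENNReal.ofReal (M.srv j) * P.serviceCount s j * F (P.liveCount π s) +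
      P.internalRate s * F (P.liveCount π s))) := by
  have h := P.tsum_balance hπ fun s => F (P.liveCount π s)
  convert h using 1
  · refine tsum_congr fun s => ?_
    by_cases hs : π s = 0
    · simp [hs]
    congr 1
    have h1 : ∀ e : P.Event s, P.rate s e * ∑' s', P.next s e s' * F (P.liveCount π s') =
        P.rate s e * F (P.countAfter s (P.liveCount π s) e) := by
      intro e
      by_cases hr : P.rate s e = 0
      · simp [hr]
      congr 1
      rw [← one_mul (F (P.countAfter s (P.liveCount π s) e)), ← (P.next s e).tsum_coe,
        ← ENNReal.tsum_mul_right]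
      refine tsum_congr fun s' => ?_
      by_cases hn : P.next s e s' = 0
      · simp [hn]
      rw [P.liveCount_next hπ hs hr hn]
    simp_rw [h1]
    rw [tsum_fintype, Fintype.sum_sum_type, Fintype.sum_sum_type]
    simp only [countAfter]
    refine congrArg₂ (· + ·) rfl (congrArg₂ (· + ·) ?_ (by simp [rate]))
    exact (P.sum_rate_departure s fun j => F (P.liveCount π s - Pi.single j 1)).symm
  · refine tsum_congr fun s => ?_
    rw [totalRate_eq, mul_assoc, add_mul, add_mul, Finset.sum_mul, Finset.sum_mul]

/-- The generator of the live job counts has mean zero on bounded functions. -/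
lemma integral_generator [NeZero I] {π : PMF P.State} (hπ : P.IsStationary π)
    (F : (Fin I → ℕ) → ℝ) (B : ℝ) (hF : ∀ x, |F x| ≤ B) :
    ∫ s, (∑ i, M.arr i * (F (P.liveCount π s + Pi.single i 1) - F (P.liveCount π s)) +
      ∑ j, M.srv j * P.serviceCount s j *
        (F (P.liveCount π s - Pi.single j 1) - F (P.liveCount π s))) ∂π.toMeasure = 0 := by
  have := P.countable_state
  set G : (Fin I → ℕ) → ℝ := fun x => F x + B with hG
  have hG0 : ∀ x, 0 ≤ G x := fun x => by have := neg_abs_le (F x); have := hF x; simp only [hG]; linarith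
  have hGB : ∀ x, G x ≤ 2 * B := fun x => by
    have := le_abs_self (F x); have := hF x; simp only [hG]; linarith
  have ha := fun i => (M.arr_pos i).le
  have hm := fun i => (M.srv_pos i).le
  set u : P.State → ℝ := fun s => ∑ i, M.arr i * G (P.liveCount π s + Pi.single i 1) +
    ∑ j, M.srv j * P.serviceCount s j * G (P.liveCount π s - Pi.single j 1) with hu
  set v : P.State → ℝ := fun s => ∑ i, M.arr i * G (P.liveCount π s) +
    ∑ j, M.srv j * P.serviceCount s j * G (P.liveCount π s) with hv
  set D : ℝ := ∑ i, M.arr i * (2 * B) + ∑ j, M.srv j * M.servers * (2 * B) with hD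
  have hsc : ∀ s j, (P.serviceCount s j : ℝ) ≤ M.servers := fun s j => by
    exact_mod_cast P.serviceCount_le s j
  have hB0 : 0 ≤ 2 * B := (hG0 0).trans (hGB 0)
  have hu0 : ∀ s, 0 ≤ u s := fun s => add_nonneg
    (Finset.sum_nonneg fun i _ => mul_nonneg (ha i) (hG0 _))
    (Finset.sum_nonneg fun j _ => mul_nonneg (mul_nonneg (hm j) (Nat.cast_nonneg _)) (hG0 _))
  have hv0 : ∀ s, 0 ≤ v s := fun s => add_nonneg
    (Finset.sum_nonneg fun i _ => mul_nonneg (ha i) (hG0 _))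
    (Finset.sum_nonneg fun j _ => mul_nonneg (mul_nonneg (hm j) (Nat.cast_nonneg _)) (hG0 _))
  have huD : ∀ s, u s ≤ D := fun s => add_le_add
    (Finset.sum_le_sum fun i _ => mul_le_mul_of_nonneg_left (hGB _) (ha i))
    (Finset.sum_le_sum fun j _ => mul_le_mul (mul_le_mul_of_nonneg_left (hsc s j) (hm j)) (hGB _)
      (hG0 _) (mul_nonneg (hm j) (Nat.cast_nonneg _)))
  have hvD : ∀ s, v s ≤ D := fun s => add_le_add
    (Finset.sum_le_sum fun i _ => mul_le_mul_of_nonneg_left (hGB _) (ha i))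
    (Finset.sum_le_sum fun j _ => mul_le_mul (mul_le_mul_of_nonneg_left (hsc s j) (hm j)) (hGB _)
      (hG0 _) (mul_nonneg (hm j) (Nat.cast_nonneg _)))
  have hui : Integrable u π.toMeasure := Integrable.of_bound (.of_discrete) D
    (.of_forall fun s => by rw [Real.norm_of_nonneg (hu0 s)]; exact huD s)
  have hvi : Integrable v π.toMeasure := Integrable.of_bound (.of_discrete) D
    (.of_forall fun s => by rw [Real.norm_of_nonneg (hv0 s)]; exact hvD s)
  have hofu : ∀ s, ENNReal.ofReal (u s) =
      ∑ i, ENNReal.ofReal (M.arr i) * ENNReal.ofReal (G (P.liveCount π s + Pi.single i 1)) +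
      ∑ j, ENNReal.ofReal (M.srv j) * P.serviceCount s j *
        ENNReal.ofReal (G (P.liveCount π s - Pi.single j 1)) := by
    intro s
    rw [hu, ENNReal.ofReal_add
      (Finset.sum_nonneg fun i _ => mul_nonneg (ha i) (hG0 _))
      (Finset.sum_nonneg fun j _ => mul_nonneg (mul_nonneg (hm j) (Nat.cast_nonneg _)) (hG0 _)),
      ENNReal.ofReal_sum_of_nonneg fun i _ => mul_nonneg (ha i) (hG0 _),
      ENNReal.ofReal_sum_of_nonneg fun j _ =>
        mul_nonneg (mul_nonneg (hm j) (Nat.cast_nonneg _)) (hG0 _)]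
    congr 1
    · exact Finset.sum_congr rfl fun i _ => ENNReal.ofReal_mul (ha i)
    · refine Finset.sum_congr rfl fun j _ => ?_
      rw [ENNReal.ofReal_mul (mul_nonneg (hm j) (Nat.cast_nonneg _)), ENNReal.ofReal_mul (hm j),
        ENNReal.ofReal_natCast]
  have hofv : ∀ s, ENNReal.ofReal (v s) =
      ∑ i, ENNReal.ofReal (M.arr i) * ENNReal.ofReal (G (P.liveCount π s)) +
      ∑ j, ENNReal.ofReal (M.srv j) * P.serviceCount s j *
        ENNReal.ofReal (G (P.liveCount π s)) := by
    intro s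
    rw [hv, ENNReal.ofReal_add
      (Finset.sum_nonneg fun i _ => mul_nonneg (ha i) (hG0 _))
      (Finset.sum_nonneg fun j _ => mul_nonneg (mul_nonneg (hm j) (Nat.cast_nonneg _)) (hG0 _)),
      ENNReal.ofReal_sum_of_nonneg fun i _ => mul_nonneg (ha i) (hG0 _),
      ENNReal.ofReal_sum_of_nonneg fun j _ =>
        mul_nonneg (mul_nonneg (hm j) (Nat.cast_nonneg _)) (hG0 _)]
    congr 1
    · exact Finset.sum_congr rfl fun i _ => ENNReal.ofReal_mul (ha i)
    · refine Finset.sum_congr rfl fun j _ => ?_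
      rw [ENNReal.ofReal_mul (mul_nonneg (hm j) (Nat.cast_nonneg _)), ENNReal.ofReal_mul (hm j),
        ENNReal.ofReal_natCast]
  have hbal := P.tsum_balance_liveCount hπ fun x => ENNReal.ofReal (G x)
  simp_rw [← add_assoc, ← hofu, ← hofv, mul_add] at hbal
  rw [ENNReal.tsum_add, ENNReal.tsum_add] at hbal
  have hfin : ∑' s, π s * (P.internalRate s * ENNReal.ofReal (G (P.liveCount π s))) ≠ ∞ := by
    refine ne_top_of_le_ne_top (P.tsum_balance_ne_top π
      (f := fun s => ENNReal.ofReal (G (P.liveCount π s))) (B := ENNReal.ofReal (2 * B))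
      ENNReal.ofReal_ne_top fun s => ENNReal.ofReal_le_ofReal (hGB _))
      (ENNReal.tsum_le_tsum fun s => ?_)
    rw [← mul_assoc]
    gcongr
    rw [totalRate_eq, ← add_assoc]
    exact le_add_self
  have hbal' := (ENNReal.add_left_inj hfin).1 hbal
  have hint : ∀ f : P.State → ℝ≥0∞, ∫⁻ s, f s ∂π.toMeasure = ∑' s, π s * f s := by
    intro f
    rw [lintegral_countable']
    refine tsum_congr fun s => ?_
    rw [PMF.toMeasure_apply_singleton _ _ (measurableSet_singleton _), mul_comm]
  rw [← hint, ← hint] at hbal'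
  have hreal : ∫ s, u s ∂π.toMeasure = ∫ s, v s ∂π.toMeasure := by
    rw [integral_eq_lintegral_of_nonneg_ae (.of_forall hu0) (.of_discrete),
      integral_eq_lintegral_of_nonneg_ae (.of_forall hv0) (.of_discrete), hbal']
  rw [← sub_eq_zero, ← integral_sub hui hvi] at hreal
  rw [← hreal]
  refine integral_congr_ae (.of_forall fun s => ?_)
  simp only [hu, hv, hG]
  rw [add_sub_add_comm, ← Finset.sum_sub_distrib, ← Finset.sum_sub_distrib]
  congr 1 <;> refine Finset.sum_congr rfl fun i _ => ?_ <;> ring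

/-! ### Little's law -/

lemma sum_arr_mul_meanWaitOfType [NeZero I] (π : PMF P.State) :
    ∑ i, ENNReal.ofReal (M.arr i) * P.meanWaitOfType π i =
      ∑' x, P.visitFlow π x * P.waitCost (some x) := by
  simp_rw [meanWaitOfType_eq, visitFlow, ← ENNReal.tsum_mul_right, ENNReal.tsum_option, waitCost,
    mul_zero, zero_add, ← ENNReal.tsum_mul_left]
  rw [← Summable.tsum_finsetSum fun i _ => ENNReal.summable, ENNReal.tsum_comm (α := P.State × ℕ)]
  refine tsum_congr fun m => ?_
  rw [← Summable.tsum_finsetSum fun i _ => ENNReal.summable]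
  refine tsum_congr fun x => ?_
  rw [Finset.sum_mul]
  simp_rw [mul_assoc]

/-- Little's law: the number of jobs in the queue, apart from those that have been there forever
and hence have never arrived, is at most the total arrival rate of waiting time. -/
lemma tsum_queueCount_le [NeZero I] (π : PMF P.State) :
    ∑' s, π s * ∑ j, (P.queueCount π s j : ℝ≥0∞) ≤
      ∑ i, ENNReal.ofReal (M.arr i) * P.meanWaitOfType π i := by
  classical
  rw [sum_arr_mul_meanWaitOfType, ENNReal.tsum_prod']
  refine ENNReal.tsum_le_tsum fun s => ?_
  have h1 : ∀ j, (P.queueCount π s j : ℝ≥0∞) = ∑ k ∈ Finset.range (P.jobs s).length,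
      if (P.jobs s)[k]? = some (j, false) ∧ P.ancientFlow π (s, k) = 0 then 1 else 0 := by
    intro j
    rw [queueCount, Finset.card_filter]
    push_cast
    rfl
  simp_rw [h1]
  rw [Finset.sum_comm, Finset.mul_sum]
  refine le_trans (Finset.sum_le_sum fun k hk => ?_)
    (ENNReal.sum_le_tsum (Finset.range (P.jobs s).length))
  rw [Finset.mem_range] at hk
  by_cases h : P.ancientFlow π (s, k) = 0 ∧ ((P.jobs s)[k]).2 = false
  · have hv : π s * P.totalRate s ≤ P.visitFlow π (s, k) := by
      rw [← show P.stationaryFlow π (s, k) = _ from if_pos hk]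
      exact tsub_eq_zero_iff_le.1 h.1
    have hw : P.waitCost (some (s, k)) = (P.totalRate s)⁻¹ := by
      simp only [waitCost]
      rw [if_pos]
      exact ⟨((P.jobs s)[k]).1, by rw [List.getElem?_eq_getElem hk, ← h.2]⟩
    rw [hw]
    refine le_trans ?_ (mul_le_mul_left hv _)
    rw [mul_assoc, ENNReal.mul_inv_cancel (P.totalRate_ne_zero s) (P.totalRate_ne_top s)]
    gcongr
    rw [Finset.sum_eq_single ((P.jobs s)[k]).1]
    · split_ifs <;> simp
    · intro j _ hj
      rw [if_neg]
      rintro ⟨h', -⟩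
      rw [List.getElem?_eq_getElem hk] at h'
      exact hj (congrArg Prod.fst (Option.some.inj h')).symm
    · simp
  · rw [Finset.sum_eq_zero, mul_zero]
    · exact zero_le
    · intro j _
      rw [if_neg]
      rintro ⟨h', ha⟩
      rw [List.getElem?_eq_getElem hk] at h'
      exact h ⟨ha, congrArg Prod.snd (Option.some.inj h')⟩

end SchedPolicy

/-! ### Job counts in steady state -/

/-- The generator of the job counts: `x` jobs are present and `z` of them are in service. -/
noncomputable def MSJSystem.generator {I : ℕ} (M : MSJSystem I) (F : (Fin I → ℕ) → ℝ)
    (x z : Fin I → ℕ) : ℝ :=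
  ∑ i, M.arr i * (F (x + Pi.single i 1) - F x) +
    ∑ j, M.srv j * z j * (F (x - Pi.single j 1) - F x)

lemma MSJSystem.generator_of_eval {I : ℕ} (M : MSJSystem I) (f : ℕ → ℝ) (j : Fin I)
    (x z : Fin I → ℕ) :
    M.generator (fun x => f (x j)) x z =
      M.arr j * (f (x j + 1) - f (x j)) +
        M.srv j * z j * (f (x j - 1) - f (x j)) := by
  rw [MSJSystem.generator]
  congr 1
  · rw [Finset.sum_eq_single j]
    · simp
    · intro i _ hi; simp [Pi.single_eq_of_ne (Ne.symm hi)]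
    · simp
  · rw [Finset.sum_eq_single j]
    · simp
    · intro i _ hi; simp [Pi.single_eq_of_ne (Ne.symm hi)]
    · simp

lemma pow_sub_one_mul_le {u v : ℝ} (hu : 0 ≤ u) (huv : u ≤ v) (z n : ℕ) (hz : z ≤ n) :
    z * u ^ (n - 1) * (v - u) ≤ v ^ n - u ^ n := by
  have hmono : (z : ℝ) * u ^ (n - 1) * (v - u) ≤ n * u ^ (n - 1) * (v - u) := by
    have : 0 ≤ v - u := sub_nonneg.2 huv
    have : (z : ℝ) ≤ n := by exact_mod_cast hz
    gcongr
  refine hmono.trans ?_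
  clear hmono hz
  induction n with
  | zero => simp
  | succ n ih =>
    have h1 : u ^ n ≤ v ^ n := pow_le_pow_left₀ hu huv n
    have h2 : 0 ≤ v - u := sub_nonneg.2 huv
    rcases n with _ | n
    · simp
    · simp only [Nat.add_sub_cancel] at ih ⊢
      push_cast at ih ⊢
      have h3 := mul_le_mul_of_nonneg_left ih hu
      have h4 := mul_le_mul_of_nonneg_right h1 h2
      ring_nf at h3 h4 ⊢
      linarith

lemma exp_neg_le_quadratic {θ : ℝ} (hθ : 0 ≤ θ) : Real.exp (-θ) ≤ 1 - θ + θ ^ 2 / 2 := by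
  have h1 := Real.quadratic_le_exp_of_nonneg hθ
  have h2 : 0 < 1 + θ + θ ^ 2 / 2 := by positivity
  rw [Real.exp_neg]
  refine (inv_anti₀ h2 h1).trans ?_
  rw [inv_le_iff_one_le_mul₀ h2]
  nlinarith [sq_nonneg (θ ^ 2)]

/-- Random job counts `L` and numbers `Z` of jobs in service, by type, that satisfy the capacity
constraint and on whose law the generator has mean zero. -/
structure IsSteadyCounts {I : ℕ} (M : MSJSystem I) {Ω : Type*} [MeasurableSpace Ω] (ν : Measure Ω)
    (L Z : Ω → Fin I → ℕ) : Prop where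
  le : ∀ s j, Z s j ≤ L s j
  capacity : ∀ s, ∑ j, M.need j * Z s j ≤ M.servers
  integral_eq_zero : ∀ (F : (Fin I → ℕ) → ℝ) (B : ℝ), (∀ x, |F x| ≤ B) →
    ∫ s, M.generator F (L s) (Z s) ∂ν = 0

namespace IsSteadyCounts

variable {I : ℕ} {M : MSJSystem I} {Ω : Type*} [MeasurableSpace Ω] {ν : Measure Ω}
  {L Z : Ω → Fin I → ℕ}

lemma service_le (h : IsSteadyCounts M ν L Z) (s : Ω) (j : Fin I) : Z s j ≤ M.servers :=
  calc Z s j ≤ M.need j * Z s j := Nat.le_mul_of_pos_left _ (M.need_pos j)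
    _ ≤ ∑ j, M.need j * Z s j := Finset.single_le_sum (f := fun j => M.need j * Z s j)
        (fun _ _ => Nat.zero_le _) (Finset.mem_univ j)
    _ ≤ _ := h.capacity s

variable [Countable Ω] [DiscreteMeasurableSpace Ω]

/-- The generator has mean zero on nonnegative functions whose increments are dominated. -/
lemma integral_eq_zero_of_dominated (h : IsSteadyCounts M ν L Z) (F : (Fin I → ℕ) → ℝ)
    (hF : ∀ x, 0 ≤ F x) (g : Ω → ℝ) (hg : Integrable g ν)
    (hle : ∀ s, ∑ i, M.arr i * |F (L s + Pi.single i 1) - F (L s)| +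
      ∑ j, M.srv j * Z s j * |F (L s - Pi.single j 1) - F (L s)| ≤ g s) :
    ∫ s, M.generator F (L s) (Z s) ∂ν = 0 := by
  have hlim := tendsto_integral_of_dominated_convergence (μ := ν) (bound := g)
    (F := fun (K : ℕ) s => M.generator (fun x => min (F x) K) (L s) (Z s))
    (f := fun s => M.generator F (L s) (Z s)) (fun K => .of_discrete) hg
    (fun K => .of_forall fun s => ?_) (.of_forall fun s => ?_)
  · refine tendsto_nhds_unique hlim ?_
    have h0 : ∀ K : ℕ, ∫ s, M.generator (fun x => min (F x) K) (L s) (Z s) ∂ν = 0 := fun K =>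
      h.integral_eq_zero _ K fun x => by
        rw [abs_of_nonneg (le_min (hF x) (Nat.cast_nonneg K))]; exact min_le_right _ _
    simp_rw [h0]
    exact tendsto_const_nhds
  · refine le_trans ?_ (hle s)
    rw [Real.norm_eq_abs, MSJSystem.generator]
    have hmin : ∀ a b : ℝ, |min a K - min b K| ≤ |a - b| := fun a b => by
      simpa using abs_min_sub_min_le_max a (K : ℝ) b K
    refine (abs_add_le _ _).trans (add_le_add ?_ ?_)
    · refine (Finset.abs_sum_le_sum_abs _ _).trans (Finset.sum_le_sum fun i _ => ?_)
      rw [abs_mul, abs_of_pos (M.arr_pos i)]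
      exact mul_le_mul_of_nonneg_left (hmin _ _) (M.arr_pos i).le
    · refine (Finset.abs_sum_le_sum_abs _ _).trans (Finset.sum_le_sum fun j _ => ?_)
      have h0 : 0 ≤ M.srv j * Z s j := mul_nonneg (M.srv_pos j).le (Nat.cast_nonneg _)
      rw [abs_mul, abs_of_nonneg h0]
      exact mul_le_mul_of_nonneg_left (hmin _ _) h0
  · have hmin : ∀ a : ℝ, Tendsto (fun K : ℕ => min a (K : ℝ)) atTop (𝓝 a) := fun a => by
      refine tendsto_const_nhds.congr' ?_
      filter_upwards [tendsto_natCast_atTop_atTop.eventually_ge_atTop a] with K hK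
      rw [min_eq_left hK]
    simp only [MSJSystem.generator]
    refine Tendsto.add ?_ ?_ <;> refine tendsto_finsetSum _ fun i _ => ?_ <;>
      exact ((hmin _).sub (hmin _)).const_mul _

variable [IsProbabilityMeasure ν]

lemma service_integrable (h : IsSteadyCounts M ν L Z) (j : Fin I) :
    Integrable (fun s => (Z s j : ℝ)) ν :=
  Integrable.of_bound .of_discrete M.servers (.of_forall fun s => by
    rw [Real.norm_of_nonneg (Nat.cast_nonneg _)]; exact_mod_cast h.service_le s j)

/-- The mean number of jobs in service is the offered load. -/
lemma integral_service (h : IsSteadyCounts M ν L Z) (j : Fin I) :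
    ∫ s, (Z s j : ℝ) ∂ν = M.arr j / M.srv j := by
  have hgen : ∀ s, M.generator (fun x => (x j : ℝ)) (L s) (Z s) = M.arr j - M.srv j * Z s j := by
    intro s
    rw [M.generator_of_eval (fun n => (n : ℝ))]
    rcases Nat.eq_zero_or_pos (Z s j) with h0 | h0
    · simp [h0]
    · have := h0.trans_le (h.le s j)
      push_cast [Nat.cast_sub this]
      ring
  have hdom := h.integral_eq_zero_of_dominated (fun x => (x j : ℝ)) (fun x => Nat.cast_nonneg _)
    (fun _ => ∑ i, M.arr i + ∑ i, M.srv i * M.servers) (integrable_const _) fun s => by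
      have hs := h.service_le s
      refine add_le_add (Finset.sum_le_sum fun i _ => ?_) (Finset.sum_le_sum fun i _ => ?_)
      · refine mul_le_of_le_one_right (M.arr_pos i).le ?_
        rcases eq_or_ne j i with rfl | hi
        · simp
        · simp [Pi.single_eq_of_ne hi]
      · rw [mul_assoc]
        refine mul_le_mul_of_nonneg_left ?_ (M.srv_pos i).le
        refine (mul_le_of_le_one_right (Nat.cast_nonneg _) ?_).trans
          (by exact_mod_cast h.service_le s i)
        rcases eq_or_ne j i with rfl | hi
        · simp only [Pi.sub_apply, Pi.single_eq_same]
          rcases Nat.eq_zero_or_pos (L s j) with h0 | h0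
          · simp [h0]
          · rw [Nat.cast_sub h0]; simp
        · simp [Pi.single_eq_of_ne hi]
  simp_rw [hgen] at hdom
  rw [integral_sub (integrable_const _) ((h.service_integrable j).const_mul _),
    integral_const_mul] at hdom
  simp only [integral_const, probReal_univ, one_smul] at hdom
  rw [eq_div_iff (M.srv_pos j).ne']
  linarith

lemma integrable_pow (j : Fin I) {u : ℝ} (hu0 : 0 ≤ u) (hu1 : u ≤ 1) :
    Integrable (fun s => u ^ L s j) ν :=
  Integrable.of_bound .of_discrete 1 (.of_forall fun s => by
    rw [Real.norm_of_nonneg (by positivity)]; exact pow_le_one₀ hu0 hu1)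

/-- The generating function `φ` of the number of type `j` jobs, with offered load `m`, satisfies a
difference version of `φ' ≥ m φ`, as the number in service is at most the number present. -/
lemma generating_step (h : IsSteadyCounts M ν L Z) (j : Fin I) {u v : ℝ} (hu : 0 ≤ u) (huv : u < v)
    (hv : v ≤ 1) : (1 + M.arr j / M.srv j * (v - u)) * ∫ s, u ^ L s j ∂ν ≤ ∫ s, v ^ L s j ∂ν := by
  have hu1 : u < 1 := huv.trans_le hv
  have hμ := M.srv_pos j
  have h0 := h.integral_eq_zero (fun x => u ^ x j) 1 fun x => by
    rw [abs_of_nonneg (by positivity)]; exact pow_le_one₀ hu hu1.le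
  have hgen : ∀ s, M.generator (fun x => u ^ x j) (L s) (Z s) =
      (1 - u) * (M.srv j * (Z s j * u ^ (L s j - 1)) - M.arr j * u ^ L s j) := by
    intro s
    rw [M.generator_of_eval (fun n => u ^ n)]
    rcases Nat.eq_zero_or_pos (Z s j) with hz | hz
    · simp only [hz, pow_succ]; push_cast; ring
    · obtain ⟨l, hl⟩ := Nat.exists_eq_add_of_le' (hz.trans_le (h.le s j))
      rw [hl]
      simp only [Nat.add_sub_cancel, pow_succ]
      ring
  have hiz : Integrable (fun s => (Z s j : ℝ) * u ^ (L s j - 1)) ν :=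
    Integrable.of_bound .of_discrete M.servers (.of_forall fun s => by
      rw [Real.norm_of_nonneg (by positivity)]
      refine (mul_le_of_le_one_right (Nat.cast_nonneg _) (pow_le_one₀ hu hu1.le)).trans ?_
      exact_mod_cast h.service_le s j)
  have hiu : Integrable (fun s => u ^ L s j) ν := integrable_pow j hu hu1.le
  have hiv : Integrable (fun s => v ^ L s j) ν := integrable_pow j (hu.trans huv.le) hv
  simp_rw [hgen] at h0
  rw [integral_const_mul, integral_sub (hiz.const_mul _) (hiu.const_mul _), integral_const_mul,
    integral_const_mul] at h0
  have h1 := (mul_eq_zero.1 h0).resolve_left (by linarith)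
  have h2 : (∫ s, (Z s j : ℝ) * u ^ (L s j - 1) ∂ν) * (v - u) ≤
      (∫ s, v ^ L s j ∂ν) - ∫ s, u ^ L s j ∂ν := by
    rw [← integral_mul_const, ← integral_sub hiv hiu]
    exact integral_mono (hiz.mul_const _) (hiv.sub hiu) fun s =>
      pow_sub_one_mul_le hu huv.le _ _ (h.le s j)
  have h3 : ∫ s, (Z s j : ℝ) * u ^ (L s j - 1) ∂ν = M.arr j / M.srv j * ∫ s, u ^ L s j ∂ν := by
    field_simp
    linarith
  rw [h3] at h2
  linarith

/-- The number of type `j` jobs present dominates a Poisson variable whose mean is the offered load,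
in the sense of generating functions. -/
lemma generating_le (h : IsSteadyCounts M ν L Z) (j : Fin I) {u : ℝ} (hu : 0 ≤ u) (hu1 : u < 1) :
    Real.exp (M.arr j / M.srv j * (1 - u)) * ∫ s, u ^ L s j ∂ν ≤ 1 := by
  set m := M.arr j / M.srv j with hm
  have hm0 : 0 < m := div_pos (M.arr_pos j) (M.srv_pos j)
  set φ : ℝ → ℝ := fun v => ∫ s, v ^ L s j ∂ν with hφ
  have key : ∀ N : ℕ, 0 < N → (1 + m * (1 - u) / N) ^ N * φ u ≤ 1 := by
    intro N hN
    have hN' : (0 : ℝ) < N := by exact_mod_cast hN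
    set d := (1 - u) / N with hd
    have hd0 : 0 < d := div_pos (by linarith) hN'
    have hind : ∀ k : ℕ, k ≤ N → (1 + m * d) ^ k * φ u ≤ φ (u + k * d) := by
      intro k
      induction k with
      | zero => simp
      | succ k ih =>
        intro hk
        have hle : u + ((k + 1 : ℕ) : ℝ) * d ≤ 1 := by
          have : ((k + 1 : ℕ) : ℝ) * d ≤ N * d := by gcongr
          rw [hd, mul_div_cancel₀ _ hN'.ne'] at this
          linarith
        have hstep := h.generating_step j (u := u + k * d) (v := u + ((k + 1 : ℕ) : ℝ) * d)
          (by positivity) (by push_cast; linarith) hle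
        have hdiff : u + ((k + 1 : ℕ) : ℝ) * d - (u + k * d) = d := by push_cast; ring
        rw [hdiff] at hstep
        refine le_trans ?_ hstep
        rw [pow_succ', mul_assoc]
        exact mul_le_mul_of_nonneg_left (ih (by omega)) (by positivity)
    have hfin := hind N le_rfl
    rw [hd, mul_div_cancel₀ _ hN'.ne'] at hfin
    have h1 : φ (u + (1 - u)) = 1 := by simp [hφ]
    rw [h1] at hfin
    rwa [← mul_div_assoc] at hfin
  have hlim := (Real.tendsto_one_add_div_pow_exp (m * (1 - u))).mul_const (φ u)
  exact le_of_tendsto hlim (eventually_atTop.2 ⟨1, fun N hN => key N hN⟩)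

lemma integrable_exp (j : Fin I) {θ : ℝ} (hθ : 0 ≤ θ) (m : ℝ) :
    Integrable (fun s => Real.exp (θ * (m - L s j))) ν :=
  Integrable.of_bound .of_discrete (Real.exp (θ * m)) (.of_forall fun s => by
    rw [Real.norm_of_nonneg (Real.exp_pos _).le]
    refine Real.exp_le_exp.2 (mul_le_mul_of_nonneg_left ?_ hθ)
    simp)

/-- Gaussian bound on the lower tail of the number of type `j` jobs present. -/
lemma integral_exp_le (h : IsSteadyCounts M ν L Z) (j : Fin I) {θ : ℝ} (hθ : 0 < θ) :
    ∫ s, Real.exp (θ * (M.arr j / M.srv j - L s j)) ∂ν ≤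
      Real.exp (M.arr j / M.srv j * (θ ^ 2 / 2)) := by
  set m := M.arr j / M.srv j with hm
  have hm0 : 0 < m := div_pos (M.arr_pos j) (M.srv_pos j)
  have hu1 : Real.exp (-θ) < 1 := by rw [Real.exp_lt_one_iff]; linarith
  have hφ := h.generating_le j (Real.exp_pos (-θ)).le hu1
  have heq : ∀ s, Real.exp (θ * (m - L s j)) = Real.exp (θ * m) * Real.exp (-θ) ^ L s j := by
    intro s
    rw [← Real.exp_nat_mul, ← Real.exp_add]
    congr 1
    ring
  simp_rw [heq]
  rw [integral_const_mul]
  have h1 : ∫ s, Real.exp (-θ) ^ L s j ∂ν ≤ Real.exp (-(m * (1 - Real.exp (-θ)))) := by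
    rw [Real.exp_neg (m * _), ← one_div, le_div_iff₀ (Real.exp_pos _), mul_comm]
    exact hφ
  refine (mul_le_mul_of_nonneg_left h1 (Real.exp_pos _).le).trans ?_
  rw [← Real.exp_add]
  refine Real.exp_le_exp.2 ?_
  nlinarith [mul_le_mul_of_nonneg_left (exp_neg_le_quadratic hθ.le) hm0.le]

end IsSteadyCounts

namespace MSJSystem

variable {I : ℕ} (M : MSJSystem I)

/-- The mean work (in server time) brought by a type `j` job to the `i`-th subsystem, which ignores
the types above `i`. -/
noncomputable def jobWork (i j : Fin I) : ℝ := if j ∈ Finset.Iic i then M.need j / M.srv j else 0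

/-- The mean work (in server time) of the jobs `x` in the `i`-th subsystem. -/
noncomputable def work (i : Fin I) (x : Fin I → ℕ) : ℝ := ∑ j, M.jobWork i j * x j

/-- The number of servers not used by the `i`-th subsystem when the jobs `z` are in service. -/
noncomputable def idle (i : Fin I) (z : Fin I → ℕ) : ℝ :=
  M.servers - ∑ j ∈ Finset.Iic i, (M.need j : ℝ) * z j

lemma idle_le (i : Fin I) (z : Fin I → ℕ) : M.idle i z ≤ M.servers :=
  sub_le_self _ (Finset.sum_nonneg fun _ _ => by positivity)

lemma jobWork_nonneg (i j : Fin I) : 0 ≤ M.jobWork i j := by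
  rw [jobWork]
  split_ifs
  · exact div_nonneg (Nat.cast_nonneg _) (M.srv_pos j).le
  · rfl

lemma work_nonneg (i : Fin I) (x : Fin I → ℕ) : 0 ≤ M.work i x :=
  Finset.sum_nonneg fun j _ => mul_nonneg (M.jobWork_nonneg i j) (Nat.cast_nonneg _)

lemma sum_jobWork_mul (i : Fin I) (f : Fin I → ℝ) :
    ∑ j, M.jobWork i j * f j = ∑ j ∈ Finset.Iic i, M.need j / M.srv j * f j := by
  simp only [jobWork, ite_mul, zero_mul]
  rw [Finset.sum_ite_mem, Finset.univ_inter]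

lemma sum_arr_mul_jobWork (i : Fin I) :
    ∑ j, M.arr j * M.jobWork i j = M.servers - M.subSlack i := by
  simp_rw [mul_comm (M.arr _)]
  rw [M.sum_jobWork_mul, subSlack, sub_sub_cancel]
  exact Finset.sum_congr rfl fun j _ => by ring

lemma sum_arr_mul_jobWork_sq (i : Fin I) :
    ∑ j, M.arr j * M.jobWork i j ^ 2 = M.subWorkVar i := by
  have h : ∀ j, M.arr j * M.jobWork i j ^ 2 = M.jobWork i j * (M.arr j * M.jobWork i j) :=
    fun j => by ring
  simp_rw [h]
  rw [M.sum_jobWork_mul, subWorkVar]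
  refine Finset.sum_congr rfl fun j hj => ?_
  rw [jobWork, if_pos hj]
  ring

lemma sum_srv_mul_jobWork (i : Fin I) (z : Fin I → ℕ) :
    ∑ j, M.srv j * z j * M.jobWork i j = M.servers - M.idle i z := by
  simp_rw [mul_comm _ (M.jobWork i _)]
  rw [M.sum_jobWork_mul, idle, sub_sub_cancel]
  refine Finset.sum_congr rfl fun j _ => ?_
  have := (M.srv_pos j).ne'
  field_simp

lemma work_add_single (i k : Fin I) (x : Fin I → ℕ) :
    M.work i (x + Pi.single k 1) = M.work i x + M.jobWork i k := by
  simp only [work, Pi.add_apply, Nat.cast_add, mul_add, Finset.sum_add_distrib]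
  congr 1
  rw [Finset.sum_eq_single k]
  · simp
  · intro j _ hj; simp [Pi.single_eq_of_ne hj]
  · simp

lemma work_sub_single (i k : Fin I) (x : Fin I → ℕ) (hk : 0 < x k) :
    M.work i (x - Pi.single k 1) = M.work i x - M.jobWork i k := by
  have h : x - Pi.single k 1 + Pi.single k 1 = x := by
    funext j
    rcases eq_or_ne j k with rfl | hj
    · simp; omega
    · simp [Pi.single_eq_of_ne hj]
  rw [eq_sub_iff_add_eq, ← work_add_single, h]

lemma sub_single_of_eq_zero (k : Fin I) (x : Fin I → ℕ) (hk : x k = 0) :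
    x - Pi.single k 1 = x := by
  funext j
  rcases eq_or_ne j k with rfl | hj
  · simp [hk]
  · simp [Pi.single_eq_of_ne hj]

lemma generator_work_sq (i : Fin I) (x z : Fin I → ℕ) (hz : ∀ j, z j ≤ x j) :
    M.generator (fun x => M.work i x ^ 2) x z =
      2 * (M.work i x * (M.idle i z - M.subSlack i)) + M.subWorkVar i +
        ∑ j, M.srv j * M.jobWork i j ^ 2 * z j := by
  have h1 : ∀ j, M.srv j * z j * (M.work i (x - Pi.single j 1) ^ 2 - M.work i x ^ 2) =
      M.srv j * M.jobWork i j ^ 2 * z j - 2 * M.work i x * (M.srv j * z j * M.jobWork i j) := by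
    intro j
    rcases Nat.eq_zero_or_pos (z j) with h0 | h0
    · simp [h0]
    · rw [M.work_sub_single i j x (h0.trans_le (hz j))]
      ring
  have h2 : ∀ j, M.arr j * (M.work i (x + Pi.single j 1) ^ 2 - M.work i x ^ 2) =
      M.arr j * M.jobWork i j ^ 2 + 2 * M.work i x * (M.arr j * M.jobWork i j) := by
    intro j
    rw [M.work_add_single]
    ring
  rw [generator]
  simp_rw [h1, h2]
  rw [Finset.sum_sub_distrib, Finset.sum_add_distrib, ← Finset.mul_sum, ← Finset.mul_sum,
    M.sum_arr_mul_jobWork, M.sum_arr_mul_jobWork_sq, M.sum_srv_mul_jobWork]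
  ring

lemma minSrv_le [NeZero I] (j : Fin I) : M.minSrv ≤ M.srv j :=
  Finset.inf'_le _ (Finset.mem_univ j)

lemma minSrv_pos [NeZero I] : 0 < M.minSrv := by
  rw [minSrv, Finset.lt_inf'_iff]
  exact fun j _ => M.srv_pos j

lemma jobWork_mul_sqrt_le [NeZero I] (i j : Fin I) :
    M.jobWork i j * √(M.arr j / M.srv j) ≤ √(M.subWorkVar i) / √M.minSrv := by
  rw [← Real.sqrt_div' _ M.minSrv_pos.le]
  refine Real.le_sqrt_of_sq_le ?_
  have hμ := M.srv_pos j
  rw [mul_pow, Real.sq_sqrt (div_nonneg (M.arr_pos j).le hμ.le), ← M.sum_arr_mul_jobWork_sq]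
  calc M.jobWork i j ^ 2 * (M.arr j / M.srv j) = M.arr j * M.jobWork i j ^ 2 / M.srv j := by ring
    _ ≤ (∑ j, M.arr j * M.jobWork i j ^ 2) / M.srv j := by
        gcongr
        exact Finset.single_le_sum (f := fun j => M.arr j * M.jobWork i j ^ 2)
          (fun j _ => mul_nonneg (M.arr_pos j).le (sq_nonneg _)) (Finset.mem_univ j)
    _ ≤ _ := by
        refine div_le_div_of_nonneg_left ?_ M.minSrv_pos (M.minSrv_le j)
        exact Finset.sum_nonneg fun j _ => mul_nonneg (M.arr_pos j).le (sq_nonneg _)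

end MSJSystem

namespace IsSteadyCounts

variable {I : ℕ} {M : MSJSystem I} {Ω : Type*} [MeasurableSpace Ω] {ν : Measure Ω}
  {L Z : Ω → Fin I → ℕ}

lemma idle_nonneg (h : IsSteadyCounts M ν L Z) (i : Fin I) (s : Ω) : 0 ≤ M.idle i (Z s) := by
  rw [MSJSystem.idle, sub_nonneg]
  have h1 : ∑ j ∈ Finset.Iic i, M.need j * Z s j ≤ M.servers :=
    (Finset.sum_le_sum_of_subset (Finset.subset_univ _)).trans (h.capacity s)
  exact_mod_cast h1

lemma norm_idle_le (h : IsSteadyCounts M ν L Z) (i : Fin I) (s : Ω) :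
    ‖M.idle i (Z s)‖ ≤ M.servers := by
  rw [Real.norm_of_nonneg (h.idle_nonneg i s)]
  exact M.idle_le i _

lemma integrable_work (i : Fin I)
    (hL : ∀ j ∈ Finset.Iic i, Integrable (fun s => (L s j : ℝ)) ν) :
    Integrable (fun s => M.work i (L s)) ν := by
  refine integrable_finsetSum _ fun j _ => ?_
  by_cases hj : j ∈ Finset.Iic i
  · exact (hL j hj).const_mul _
  · simp [MSJSystem.jobWork, hj]

variable [Countable Ω] [DiscreteMeasurableSpace Ω] [IsProbabilityMeasure ν]

lemma integrable_idle (h : IsSteadyCounts M ν L Z) (i : Fin I) :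
    Integrable (fun s => M.idle i (Z s)) ν :=
  Integrable.of_bound .of_discrete M.servers (.of_forall (h.norm_idle_le i))

/-- The mean number of servers that a subsystem leaves idle is its slack capacity. -/
lemma integral_idle (h : IsSteadyCounts M ν L Z) (i : Fin I) :
    ∫ s, M.idle i (Z s) ∂ν = M.subSlack i := by
  simp only [MSJSystem.idle]
  rw [integral_sub (integrable_const _)
    (integrable_finsetSum _ fun j _ => (h.service_integrable j).const_mul _),
    integral_finsetSum _ fun j _ => (h.service_integrable j).const_mul _]
  simp_rw [integral_const_mul, h.integral_service]
  simp only [integral_const, probReal_univ, one_smul, MSJSystem.subSlack]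
  congr 1
  exact Finset.sum_congr rfl fun j _ => by ring

lemma subSlack_nonneg (h : IsSteadyCounts M ν L Z) (i : Fin I) : 0 ≤ M.subSlack i := by
  rw [← h.integral_idle i]
  exact integral_nonneg (h.idle_nonneg i)

/-- A shortfall of the number of type `j` jobs below the offered load rarely coincides with idle
servers: up to an event of probability of order `1 / n`, it is at most `log n` standard
deviations. -/
lemma integral_shortfall_mul_idle_le (h : IsSteadyCounts M ν L Z) (i j : Fin I)
    (hn : 1 ≤ M.servers) (hL : Integrable (fun s => (L s j : ℝ)) ν) :
    ∫ s, (M.arr j / M.srv j - L s j) * M.idle i (Z s) ∂ν ≤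
      √(M.arr j / M.srv j) * (M.subSlack i * Real.log M.servers + 2) := by
  set m := M.arr j / M.srv j with hm
  have hm0 : 0 < m := div_pos (M.arr_pos j) (M.srv_pos j)
  set r := √m with hr
  have hr0 : 0 < r := Real.sqrt_pos.2 hm0
  have hn0 : (0 : ℝ) < M.servers := by exact_mod_cast hn
  have hexp := h.integral_exp_le j (θ := r⁻¹) (by positivity)
  rw [← hm] at hexp
  have h2 : Real.exp (m * (r⁻¹ ^ 2 / 2)) ≤ 2 := by
    have : m * (r⁻¹ ^ 2 / 2) = 1 / 2 := by
      rw [inv_pow, hr, Real.sq_sqrt hm0.le]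
      field_simp
    rw [this]
    have h3 : Real.exp (1 / 2) ^ 2 ≤ 2 ^ 2 := by
      rw [← Real.exp_nat_mul]
      norm_num
      linarith [Real.exp_one_lt_d9]
    exact le_of_sq_le_sq h3 (by norm_num)
  -- `x ≤ t + r * exp (x / r - t / r)` with `t = r * log n`
  have hpt : ∀ s, (m - L s j) * M.idle i (Z s) ≤
      r * Real.log M.servers * M.idle i (Z s) + r * Real.exp (r⁻¹ * (m - L s j)) := by
    intro s
    set x := m - L s j with hx
    have h1 : x ≤ r * Real.log M.servers + r * (Real.exp (r⁻¹ * x) / M.servers) := by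
      have h4 := Real.add_one_le_exp (r⁻¹ * x - Real.log M.servers)
      rw [Real.exp_sub, Real.exp_log hn0] at h4
      have h5 := mul_le_mul_of_nonneg_left h4 hr0.le
      have h6 : r * (r⁻¹ * x - Real.log M.servers + 1) = x - r * Real.log M.servers + r := by
        field_simp
      rw [h6] at h5
      linarith
    calc x * M.idle i (Z s)
        ≤ (r * Real.log M.servers + r * (Real.exp (r⁻¹ * x) / M.servers)) * M.idle i (Z s) :=
          mul_le_mul_of_nonneg_right h1 (h.idle_nonneg i s)
      _ = r * Real.log M.servers * M.idle i (Z s) +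
          r * (Real.exp (r⁻¹ * x) / M.servers) * M.idle i (Z s) := by ring
      _ ≤ r * Real.log M.servers * M.idle i (Z s) +
          r * (Real.exp (r⁻¹ * x) / M.servers) * M.servers := by
          gcongr
          exact M.idle_le i _
      _ = _ := by field_simp
  have hidle := h.integrable_idle i
  have hie := integrable_exp (ν := ν) (L := L) j (inv_nonneg.2 hr0.le) m
  have hint : Integrable (fun s => (m - L s j) * M.idle i (Z s)) ν :=
    ((integrable_const m).sub hL).mul_bdd .of_discrete
      (.of_forall (h.norm_idle_le i))
  refine (integral_mono hint ((hidle.const_mul _).add (hie.const_mul _)) hpt).trans ?_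
  simp only [Pi.add_apply]
  rw [integral_add (hidle.const_mul _) (hie.const_mul _), integral_const_mul, integral_const_mul,
    h.integral_idle]
  nlinarith [mul_le_mul_of_nonneg_left (hexp.trans h2) hr0.le]

/-- The balance equation of the squared work: the covariance of the work with the idleness is minus
the work variability. -/
lemma integral_work_mul (h : IsSteadyCounts M ν L Z) (i : Fin I)
    (hL : ∀ j ∈ Finset.Iic i, Integrable (fun s => (L s j : ℝ)) ν) :
    ∫ s, M.work i (L s) * (M.idle i (Z s) - M.subSlack i) ∂ν = -M.subWorkVar i := by
  have hw : Integrable (fun s => M.work i (L s)) ν := integrable_work i hL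
  have hdom := h.integral_eq_zero_of_dominated (fun x => M.work i x ^ 2) (fun x => sq_nonneg _)
    (fun s => ∑ k, M.arr k * (2 * M.work i (L s) * M.jobWork i k + M.jobWork i k ^ 2) +
      ∑ k, M.srv k * M.servers * (2 * M.work i (L s) * M.jobWork i k + M.jobWork i k ^ 2))
    (by
      refine Integrable.add ?_ ?_ <;> refine integrable_finsetSum _ fun k _ => ?_ <;>
        exact ((((hw.const_mul 2).mul_const _).add (integrable_const _)).const_mul _))
    (fun s => by
      have hw0 := M.work_nonneg i (L s)
      refine add_le_add (Finset.sum_le_sum fun k _ => ?_) (Finset.sum_le_sum fun k _ => ?_)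
      · refine mul_le_mul_of_nonneg_left ?_ (M.arr_pos k).le
        have hb := M.jobWork_nonneg i k
        rw [M.work_add_single, abs_of_nonneg] <;> nlinarith [mul_nonneg hw0 hb]
      · have hb := M.jobWork_nonneg i k
        have hz : (Z s k : ℝ) ≤ M.servers := by exact_mod_cast h.service_le s k
        refine mul_le_mul (mul_le_mul_of_nonneg_left hz (M.srv_pos k).le) ?_ (abs_nonneg _)
          (mul_nonneg (M.srv_pos k).le (Nat.cast_nonneg _))
        rcases Nat.eq_zero_or_pos (L s k) with h0 | h0
        · rw [MSJSystem.sub_single_of_eq_zero k _ h0, sub_self, abs_zero]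
          positivity
        · rw [M.work_sub_single i k _ h0, abs_le]
          constructor <;> nlinarith [mul_nonneg hw0 hb])
  simp_rw [fun s => M.generator_work_sq i (L s) (Z s) (h.le s)] at hdom
  have hi1 : Integrable (fun s => M.work i (L s) * (M.idle i (Z s) - M.subSlack i)) ν :=
    hw.mul_bdd (c := M.servers + ‖M.subSlack i‖) .of_discrete (.of_forall fun s =>
      (norm_sub_le _ _).trans (add_le_add_left (h.norm_idle_le i s) _))
  have hi2 : Integrable (fun s => ∑ j, M.srv j * M.jobWork i j ^ 2 * (Z s j : ℝ)) ν :=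
    integrable_finsetSum _ fun j _ => (h.service_integrable j).const_mul _
  have hi3 : Integrable (fun s => 2 * (M.work i (L s) * (M.idle i (Z s) - M.subSlack i)) +
      M.subWorkVar i) ν := (hi1.const_mul 2).add (integrable_const _)
  rw [integral_add hi3 hi2,
    integral_add (hi1.const_mul 2) (integrable_const _), integral_const_mul,
    integral_finsetSum _ fun j _ => (h.service_integrable j).const_mul _] at hdom
  simp_rw [integral_const_mul, h.integral_service] at hdom
  have hsum : ∑ j, M.srv j * M.jobWork i j ^ 2 * (M.arr j / M.srv j) = M.subWorkVar i := by
    rw [← M.sum_arr_mul_jobWork_sq]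
    refine Finset.sum_congr rfl fun j _ => ?_
    have := (M.srv_pos j).ne'
    field_simp
  rw [hsum] at hdom
  simp only [integral_const, probReal_univ, one_smul] at hdom
  linarith

/-- The lower bound on the mean work in the queue of a subsystem. -/
lemma le_subSlack_mul_queue_work [NeZero I] (h : IsSteadyCounts M ν L Z) (i : Fin I)
    (hn : 1 ≤ M.servers) (hL : ∀ j ∈ Finset.Iic i, Integrable (fun s => (L s j : ℝ)) ν) :
    M.subWorkVar i - I * (√(M.subWorkVar i) / √M.minSrv) *
      (M.subSlack i * Real.log M.servers + 2) ≤
      M.subSlack i * ∑ j ∈ Finset.Iic i, M.need j / M.srv j * ∫ s, ((L s j : ℝ) - Z s j) ∂ν := by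
  set δ := M.subSlack i with hδ
  have hw : Integrable (fun s => M.work i (L s)) ν := integrable_work i hL
  have hidle := h.integrable_idle i
  have hcov := h.integral_work_mul i hL
  have hwi : Integrable (fun s => M.work i (L s) * M.idle i (Z s)) ν :=
    hw.mul_bdd .of_discrete (.of_forall (h.norm_idle_le i))
  have hcov' : ∫ s, M.work i (L s) * M.idle i (Z s) ∂ν - δ * ∫ s, M.work i (L s) ∂ν =
      -M.subWorkVar i := by
    rw [← hcov, ← integral_const_mul, ← integral_sub hwi (hw.const_mul _)]
    congr 1; funext s; ring
  have hjob : ∀ j, M.jobWork i j * ∫ s, (M.arr j / M.srv j - L s j) * M.idle i (Z s) ∂ν ≤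
      √(M.subWorkVar i) / √M.minSrv * (δ * Real.log M.servers + 2) := by
    intro j
    have hpos : 0 ≤ δ * Real.log M.servers + 2 := by
      have := h.subSlack_nonneg i
      have : 0 ≤ Real.log M.servers := Real.log_natCast_nonneg _
      positivity
    by_cases hj : j ∈ Finset.Iic i
    · refine (mul_le_mul_of_nonneg_left (h.integral_shortfall_mul_idle_le i j hn (hL j hj))
        (M.jobWork_nonneg i j)).trans ?_
      rw [← mul_assoc]
      exact mul_le_mul_of_nonneg_right (M.jobWork_mul_sqrt_le i j) hpos
    · rw [MSJSystem.jobWork, if_neg hj, zero_mul]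
      positivity
  have hsum := Finset.sum_le_sum fun j (_ : j ∈ Finset.univ) => hjob j
  rw [Finset.sum_const, Finset.card_univ, Fintype.card_fin, nsmul_eq_mul, ← mul_assoc] at hsum
  have hsplit : ∑ j, M.jobWork i j * ∫ s, (M.arr j / M.srv j - L s j) * M.idle i (Z s) ∂ν =
      (∑ j, M.jobWork i j * (M.arr j / M.srv j)) * δ - ∫ s, M.work i (L s) * M.idle i (Z s) ∂ν := by
    have hterm : ∀ j ∈ Finset.Iic i, Integrable (fun s => (L s j : ℝ) * M.idle i (Z s)) ν :=
      fun j hj => (hL j hj).mul_bdd .of_discrete (.of_forall (h.norm_idle_le i))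
    have h1 : ∫ s, M.work i (L s) * M.idle i (Z s) ∂ν =
        ∑ j, M.jobWork i j * ∫ s, (L s j : ℝ) * M.idle i (Z s) ∂ν := by
      rw [M.sum_jobWork_mul]
      simp_rw [← integral_const_mul]
      rw [← integral_finsetSum _ fun j hj => (hterm j hj).const_mul _]
      congr 1; funext s
      rw [MSJSystem.work, M.sum_jobWork_mul, Finset.sum_mul]
      exact Finset.sum_congr rfl fun j _ => by ring
    rw [h1, M.sum_jobWork_mul, M.sum_jobWork_mul, M.sum_jobWork_mul, Finset.sum_mul,
      ← Finset.sum_sub_distrib]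
    refine Finset.sum_congr rfl fun j hj => ?_
    simp_rw [sub_mul]
    rw [integral_sub (hidle.const_mul _) (hterm j hj), integral_const_mul, h.integral_idle]
    ring
  have hqueue : ∑ j ∈ Finset.Iic i, M.need j / M.srv j * ∫ s, ((L s j : ℝ) - Z s j) ∂ν =
      ∫ s, M.work i (L s) ∂ν - ∑ j, M.jobWork i j * (M.arr j / M.srv j) := by
    have h1 : ∫ s, M.work i (L s) ∂ν =
        ∑ j ∈ Finset.Iic i, M.need j / M.srv j * ∫ s, (L s j : ℝ) ∂ν := by
      simp_rw [← integral_const_mul]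
      rw [← integral_finsetSum _ fun j hj => (hL j hj).const_mul _]
      congr 1; funext s
      rw [MSJSystem.work, M.sum_jobWork_mul]
    rw [h1, M.sum_jobWork_mul, ← Finset.sum_sub_distrib]
    refine Finset.sum_congr rfl fun j hj => ?_
    rw [integral_sub (hL j hj) (h.service_integrable j), h.integral_service]
    ring
  rw [hqueue]
  rw [hsplit] at hsum
  nlinarith

end IsSteadyCounts

namespace MSJSystem

variable {I : ℕ} (M : MSJSystem I)

lemma subSlack_anti {i k : Fin I} (h : i ≤ k) : M.subSlack k ≤ M.subSlack i := by
  refine sub_le_sub_left (Finset.sum_le_sum_of_subset_of_nonneg (Finset.Iic_subset_Iic.2 h) ?_) _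
  exact fun j _ _ => div_nonneg (mul_nonneg (M.arr_pos j).le (Nat.cast_nonneg _)) (M.srv_pos j).le

lemma subWorkVar_mono {i k : Fin I} (h : i ≤ k) : M.subWorkVar i ≤ M.subWorkVar k := by
  refine Finset.sum_le_sum_of_subset_of_nonneg (Finset.Iic_subset_Iic.2 h) ?_
  exact fun j _ _ => div_nonneg (mul_nonneg (M.arr_pos j).le (sq_nonneg _)) (sq_nonneg _)

lemma subWorkVar_pos (i : Fin I) : 0 < M.subWorkVar i := by
  refine Finset.sum_pos (fun j _ => ?_) ⟨i, Finset.mem_Iic.2 le_rfl⟩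
  have h1 := M.arr_pos j
  have h2 := M.srv_pos j
  have h3 : (0 : ℝ) < M.need j := by exact_mod_cast M.need_pos j
  positivity

lemma slack_le_subSlack (i : Fin I) : M.slack ≤ M.subSlack i := by
  refine sub_le_sub_left (Finset.sum_le_sum_of_subset_of_nonneg (Finset.subset_univ _) ?_) _
  exact fun j _ _ => div_nonneg (mul_nonneg (M.arr_pos j).le (Nat.cast_nonneg _)) (M.srv_pos j).le

lemma totalArr_pos [NeZero I] : 0 < M.totalArr :=
  Finset.sum_pos (fun i _ => M.arr_pos i) Finset.univ_nonempty

/-- The relative error in the lower bound for the work in the queue of the `i`-th subsystem. -/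
noncomputable def relError [NeZero I] (i : Fin I) : ℝ :=
  I * (M.subSlack i * Real.log M.servers + 2) / (√(M.subWorkVar i) * √M.minSrv)

end MSJSystem

namespace SchedPolicy

variable {I : ℕ} {M : MSJSystem I} (P : SchedPolicy M)

lemma isSteadyCounts [NeZero I] {π : PMF P.State} (hπ : P.IsStationary π) :
    IsSteadyCounts M π.toMeasure (P.liveCount π) P.serviceCount where
  le s j := by
    have := P.serviceCount_add_queueCount hπ s j
    omega
  capacity := P.sum_need_mul_serviceCount_le
  integral_eq_zero := P.integral_generator hπ

/-- The lower bound on the mean waiting time in one system. -/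
lemma le_meanWait [NeZero I] {π : PMF P.State} (hπ : P.IsStationary π) (hn : 1 ≤ M.servers)
    (i : Fin I) (hδ : 0 < M.subSlack i) :
    ENNReal.ofReal ((1 / M.totalArr) * (M.minSrv * M.subWorkVar i /
      (M.need i * M.subSlack i)) * (1 - M.relError i)) ≤ P.meanWait π := by
  have := P.countable_state
  have hΛ := M.totalArr_pos
  have hμ := M.minSrv_pos
  have hσ := M.subWorkVar_pos i
  have hℓ : (0 : ℝ) < M.need i := by exact_mod_cast M.need_pos i
  rw [mul_assoc, one_div_mul_eq_div, ENNReal.ofReal_div_of_pos hΛ, meanWait]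
  refine ENNReal.div_le_div_right (le_trans ?_ (P.tsum_queueCount_le π)) _
  by_cases hA : ∑' s, π s * ∑ j, (P.queueCount π s j : ℝ≥0∞) = ∞
  · rw [hA]; exact le_top
  have hlint : ∫⁻ s, ENNReal.ofReal (∑ j, (P.queueCount π s j : ℝ)) ∂π.toMeasure =
      ∑' s, π s * ∑ j, (P.queueCount π s j : ℝ≥0∞) := by
    rw [lintegral_countable']
    refine tsum_congr fun s => ?_
    rw [PMF.toMeasure_apply_singleton _ _ (measurableSet_singleton _), mul_comm,
      ENNReal.ofReal_sum_of_nonneg fun _ _ => Nat.cast_nonneg _]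
    simp
  have hQ0 : ∀ s, 0 ≤ ∑ j, (P.queueCount π s j : ℝ) := fun s =>
    Finset.sum_nonneg fun _ _ => Nat.cast_nonneg _
  have hQ : Integrable (fun s => ∑ j, (P.queueCount π s j : ℝ)) π.toMeasure := by
    refine ⟨.of_discrete, ?_⟩
    rw [hasFiniteIntegral_iff_ofReal (.of_forall hQ0), hlint]
    exact lt_top_iff_ne_top.2 hA
  have hQj : ∀ j, Integrable (fun s => (P.queueCount π s j : ℝ)) π.toMeasure := fun j =>
    hQ.mono' .of_discrete (.of_forall fun s => by
      rw [Real.norm_of_nonneg (Nat.cast_nonneg _)]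
      exact Finset.single_le_sum (f := fun j => (P.queueCount π s j : ℝ))
        (fun _ _ => Nat.cast_nonneg _) (Finset.mem_univ j))
  have hst := P.isSteadyCounts hπ
  have hcount : ∀ s j, (P.liveCount π s j : ℝ) = P.serviceCount s j + P.queueCount π s j :=
    fun s j => by exact_mod_cast (P.serviceCount_add_queueCount hπ s j).symm
  have hL : ∀ j ∈ Finset.Iic i, Integrable (fun s => (P.liveCount π s j : ℝ)) π.toMeasure := by
    intro j _
    simp_rw [hcount]
    exact (hst.service_integrable j).add (hQj j)
  have hmain := hst.le_subSlack_mul_queue_work i hn hL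
  simp_rw [hcount, add_sub_cancel_left] at hmain
  rw [← hlint, ← ofReal_integral_eq_lintegral_ofReal hQ (.of_forall hQ0)]
  refine ENNReal.ofReal_le_ofReal ?_
  have hwork : ∑ j ∈ Finset.Iic i, M.need j / M.srv j * ∫ s, (P.queueCount π s j : ℝ) ∂π.toMeasure ≤
      M.need i / M.minSrv * ∫ s, ∑ j, (P.queueCount π s j : ℝ) ∂π.toMeasure := by
    rw [integral_finsetSum _ fun j _ => hQj j, Finset.mul_sum]
    refine le_trans (Finset.sum_le_sum fun j hj => ?_)
      (Finset.sum_le_sum_of_subset_of_nonneg (Finset.subset_univ (Finset.Iic i)) fun j _ _ => ?_)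
    · refine mul_le_mul_of_nonneg_right ?_ (integral_nonneg fun _ => Nat.cast_nonneg _)
      have hle : (M.need j : ℝ) ≤ M.need i := by exact_mod_cast M.need_mono (Finset.mem_Iic.1 hj)
      exact div_le_div₀ hℓ.le hle hμ (M.minSrv_le j)
    · exact mul_nonneg (by positivity) (integral_nonneg fun _ => Nat.cast_nonneg _)
  have hrel : M.subWorkVar i * (1 - M.relError i) = M.subWorkVar i -
      I * (√(M.subWorkVar i) / √M.minSrv) * (M.subSlack i * Real.log M.servers + 2) := by
    have hs := Real.sqrt_pos.2 hσ
    have hm := Real.sqrt_pos.2 hμ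
    rw [MSJSystem.relError]
    field_simp
    linear_combination I * (M.subSlack i * Real.log M.servers + 2) * Real.mul_self_sqrt hσ.le
  have hfin := hrel.le.trans (hmain.trans (mul_le_mul_of_nonneg_left hwork hδ.le))
  calc M.minSrv * M.subWorkVar i / (M.need i * M.subSlack i) * (1 - M.relError i)
      = M.minSrv / (M.need i * M.subSlack i) * (M.subWorkVar i * (1 - M.relError i)) := by ring
    _ ≤ M.minSrv / (M.need i * M.subSlack i) * (M.subSlack i * (M.need i / M.minSrv *
        ∫ s, ∑ j, (P.queueCount π s j : ℝ) ∂π.toMeasure)) :=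
      mul_le_mul_of_nonneg_left hfin (by positivity)
    _ = _ := by field_simp

end SchedPolicy

/-! ### Heavy traffic -/

section HeavyTraffic

variable {I : ℕ} {sys : ℕ → MSJSystem I}

lemma eventually_one_le_slack [NeZero I] (hneed : ∃ ε₀ : ℝ, 0 < ε₀ ∧ ε₀ < 1 ∧
    ∀ᶠ n in atTop, ((sys n).maxNeed : ℝ) ≤ ε₀ * (sys n).slack) :
    ∀ᶠ n in atTop, 1 ≤ (sys n).slack := by
  obtain ⟨ε₀, h0, h1, h⟩ := hneed
  filter_upwards [h] with n hn
  have hmax : 1 ≤ (sys n).maxNeed :=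
    ((sys n).need_pos 0).trans_le (Finset.le_sup (f := (sys n).need) (Finset.mem_univ 0))
  have hmax' : (1 : ℝ) ≤ (sys n).maxNeed := by exact_mod_cast hmax
  nlinarith

lemma last_mem_heavySubsystems [NeZero I]
    (htraffic : (fun n => (sys n).slack) =o[atTop]
      fun n : ℕ => √((sys n).workVar) / Real.log n) :
    (⊤ : Fin I) ∈ heavySubsystems sys := by
  simpa only [heavySubsystems, Set.mem_ofPred_eq, MSJSystem.subSlack, MSJSystem.subWorkVar,
    MSJSystem.slack, MSJSystem.workVar, Finset.Iic_top] using htraffic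

lemma mem_heavySubsystems_of_le {i k : Fin I} (hi : i ∈ heavySubsystems sys) (hik : i ≤ k)
    (hslack : ∀ᶠ n in atTop, 1 ≤ (sys n).slack) : k ∈ heavySubsystems sys := by
  have h1 : (fun n => (sys n).subSlack k) =O[atTop] fun n => (sys n).subSlack i := by
    refine IsBigO.of_bound' ?_
    filter_upwards [hslack] with n hn
    have hk := (sys n).slack_le_subSlack k
    have hki := (sys n).subSlack_anti hik
    rw [Real.norm_of_nonneg (by linarith), Real.norm_of_nonneg (by linarith)]
    exact hki
  have h2 : (fun n : ℕ => √((sys n).subWorkVar i) / Real.log n) =O[atTop]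
      fun n : ℕ => √((sys n).subWorkVar k) / Real.log n := by
    refine IsBigO.of_bound' (.of_forall fun n => ?_)
    have := Real.log_natCast_nonneg n
    rw [Real.norm_of_nonneg (by positivity), Real.norm_of_nonneg (by positivity)]
    gcongr
    exact (sys n).subWorkVar_mono hik
  exact (h1.trans_isLittleO hi).trans_isBigO h2

lemma tendsto_relError [NeZero I] {μ : Fin I → ℝ} (hservers : ∀ n, (sys n).servers = n)
    (hsrv : ∀ n, (sys n).srv = μ) (hslack : ∀ᶠ n in atTop, 1 ≤ (sys n).slack) {i : Fin I}
    (hi : i ∈ heavySubsystems sys) : Tendsto (fun n => (sys n).relError i) atTop (𝓝 0) := by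
  have h1 : Tendsto (fun n : ℕ => (sys n).subSlack i * Real.log n / √((sys n).subWorkVar i))
      atTop (𝓝 0) := by
    refine (IsLittleO.tendsto_div_nhds_zero hi).congr fun n => ?_
    rw [div_div_eq_mul_div]
  have hlog : ∀ᶠ n : ℕ in atTop, 1 ≤ Real.log n :=
    (Real.tendsto_log_atTop.comp tendsto_natCast_atTop_atTop).eventually_ge_atTop 1
  -- the slack is at least one, so the work variability tends to infinity
  have h2 : Tendsto (fun n : ℕ => 1 / √((sys n).subWorkVar i)) atTop (𝓝 0) := by
    refine squeeze_zero' (.of_forall fun n => by positivity) ?_ h1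
    filter_upwards [hslack, hlog] with n hn hl
    have := (sys n).slack_le_subSlack i
    gcongr
    nlinarith
  have h3 := (h1.add (h2.const_mul 2)).const_mul (I / √(Finset.univ.inf' Finset.univ_nonempty μ))
  simp only [mul_zero, add_zero] at h3
  refine h3.congr fun n => ?_
  rw [MSJSystem.relError, MSJSystem.minSrv, hservers, hsrv]
  have h4 := Real.sqrt_pos.2 ((sys n).subWorkVar_pos i)
  have h5 : 0 < √(Finset.univ.inf' Finset.univ_nonempty μ) := by
    have := (sys n).minSrv_pos
    rw [MSJSystem.minSrv, hsrv] at this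
    exact Real.sqrt_pos.2 this
  field_simp

end HeavyTraffic

theorem theorem2 {I : ℕ} [NeZero I] (μ : Fin I → ℝ) (sys : ℕ → MSJSystem I)
    (hservers : ∀ n, (sys n).servers = n)
    (hsrv : ∀ n, (sys n).srv = μ)
    (htraffic : (fun n => (sys n).slack) =o[atTop]
      fun n : ℕ => √((sys n).workVar) / Real.log n)
    (hneed : ∃ ε₀ : ℝ, 0 < ε₀ ∧ ε₀ < 1 ∧
      ∀ᶠ n in atTop, ((sys n).maxNeed : ℝ) ≤ ε₀ * (sys n).slack) :
    ∃ istar : Fin I, IsLeast (heavySubsystems sys) istar ∧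
      (∃ ε : ℕ → ℝ, Tendsto ε atTop (𝓝 0) ∧
        ∀ᶠ n in atTop, ∀ (P : SchedPolicy (sys n)) (π : PMF P.State), P.IsStationary π →
          ENNReal.ofReal
            ((Finset.Ici istar).sup' Finset.nonempty_Ici (fun i =>
                (1 / (sys n).totalArr) * ((sys n).minSrv * (sys n).subWorkVar i /
                  ((sys n).need i * (sys n).subSlack i))) * (1 - ε n))
            ≤ P.meanWait π) ∧
      (∃ c : ℝ, 0 < c ∧
        ∀ᶠ n in atTop, ∀ (P : SchedPolicy (sys n)) (π : PMF P.State), P.IsStationary π →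
          ENNReal.ofReal
            (c * (Finset.Ici istar).sup' Finset.nonempty_Ici (fun i =>
                (1 / (sys n).totalArr) * ((sys n).subWorkVar i /
                  ((sys n).need i * (sys n).subSlack i))))
            ≤ P.meanWait π) := by
  have hslack := eventually_one_le_slack hneed
  obtain ⟨istar, hmem, hmin⟩ := Set.exists_min_image (heavySubsystems sys) id (Set.toFinite _)
    ⟨⊤, last_mem_heavySubsystems htraffic⟩
  set ε : ℕ → ℝ := fun n => ∑ i ∈ Finset.Ici istar, (sys n).relError i with hε
  have hε0 : Tendsto ε atTop (𝓝 0) := by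
    have := tendsto_finsetSum (Finset.Ici istar) fun i hi => tendsto_relError hservers hsrv hslack
      (mem_heavySubsystems_of_le hmem (Finset.mem_Ici.1 hi) hslack)
    simpa using this
  have key : ∀ᶠ n in atTop, ∀ i ∈ Finset.Ici istar, ∀ (P : SchedPolicy (sys n))
      (π : PMF P.State), P.IsStationary π →
      ENNReal.ofReal ((1 / (sys n).totalArr) * ((sys n).minSrv * (sys n).subWorkVar i /
        ((sys n).need i * (sys n).subSlack i)) * (1 - ε n)) ≤ P.meanWait π := by
    filter_upwards [hslack, eventually_ge_atTop 1] with n hn hn1 i hi P π hπ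
    have hpos : ∀ k, 0 < (sys n).subSlack k := fun k => by
      have := (sys n).slack_le_subSlack k
      linarith
    refine le_trans (ENNReal.ofReal_le_ofReal ?_)
      (P.le_meanWait hπ (by rw [hservers]; exact hn1) i (hpos i))
    have h1 := (sys n).totalArr_pos
    have h2 := (sys n).minSrv_pos
    have h3 := (sys n).subWorkVar_pos i
    have h4 := hpos i
    have h5 : (sys n).relError i ≤ ε n :=
      Finset.single_le_sum (f := fun i => (sys n).relError i) (fun k _ => by
        have := hpos k
        have := Real.log_natCast_nonneg (sys n).servers
        rw [MSJSystem.relError]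
        positivity) hi
    gcongr
  refine ⟨istar, ⟨hmem, fun i hi => hmin i hi⟩, ⟨ε, hε0, ?_⟩,
    Finset.univ.inf' Finset.univ_nonempty μ / 2, ?_, ?_⟩
  · filter_upwards [key] with n hn P π hπ
    obtain ⟨i, hi, heq⟩ := Finset.exists_mem_eq_sup' (Finset.nonempty_Ici (a := istar))
      (fun i => (1 / (sys n).totalArr) * ((sys n).minSrv * (sys n).subWorkVar i /
        ((sys n).need i * (sys n).subSlack i)))
    rw [heq]
    exact hn i hi P π hπ
  · have := (sys 0).minSrv_pos
    rw [MSJSystem.minSrv, hsrv] at this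
    exact half_pos this
  · filter_upwards [key, hε0.eventually_le_const (by norm_num : (0 : ℝ) < 1 / 2), hslack]
      with n hn hhalf hs P π hπ
    obtain ⟨i, hi, heq⟩ := Finset.exists_mem_eq_sup' (Finset.nonempty_Ici (a := istar))
      (fun i => (1 / (sys n).totalArr) * ((sys n).subWorkVar i /
        ((sys n).need i * (sys n).subSlack i)))
    rw [heq]
    refine le_trans (ENNReal.ofReal_le_ofReal ?_) (hn i hi P π hπ)
    have h1 := (sys n).totalArr_pos
    have h2 := (sys n).minSrv_pos
    have h3 := (sys n).subWorkVar_pos i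
    have h4 : 0 < (sys n).subSlack i := by
      have := (sys n).slack_le_subSlack i
      linarith
    have h5 : Finset.univ.inf' Finset.univ_nonempty μ = (sys n).minSrv := by
      rw [MSJSystem.minSrv, hsrv]
    rw [h5]
    calc (sys n).minSrv / 2 * (1 / (sys n).totalArr * ((sys n).subWorkVar i /
          ((sys n).need i * (sys n).subSlack i)))
        = 1 / (sys n).totalArr * ((sys n).minSrv * (sys n).subWorkVar i /
          ((sys n).need i * (sys n).subSlack i)) * (1 - 1 / 2) := by ring
      _ ≤ _ := by gcongr
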